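/- Let $W$ be a Cauchy white noise on $\mathbb{R}^2$, that is, an independently scattered, a.s. countably additive random measure such that, for every Borel set $A$ of finite area $|A|$, $W(A)$ has the Cauchy distribution with location $0$ and scale $|A|$ (with $W(A)=0$ a.s. if $|A|=0$). Let $k:\mathbb{R}^2\times\mathbb{R}^2\to[0,\infty)$ be a kernel with $k(s,s^*)\le k_{\max}<\infty$ for all $s,s^*$ and with $k(s,\cdot)$ integrable for every $s$. Let $Z(s)=\int_{\mathbb{R}^2}k(s,s^*)\,W(ds^*)$, where the integral is the limit in probability of the integrals of integrable simple functions converging to $k(s,\cdot)$ in $L^1$. Let $s_1,\dots,s_d\in\mathbb{R}^2$ be sites with $\int k(s_j,s^*)\,ds^*>0$ for every $j$, and put $$\zeta(s_j,x)=\frac{k(s_j,x)}{\int_{\mathbb{R}^2}k(s_j,s^*)\,ds^*},\qquad \ell(w_1,\dots,w_d)=\int_{\mathbb{R}^2}\max_{j=1,\dots,d}w_j\,\zeta(s_j,x)\,dx,\qquad w\in[0,\infty)^d.$$ Then: (1) The integral $\ell(w)$ converges for every $w\in[0,\infty)^d$, and $\ell$ is the stable tail dependence function of $(Z(s_1),\dots,Z(s_d))$: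 if $C$ is the copula of this vector, then $$\lim_{n\to\infty}C^n(u_1^{1/n},\dots,u_d^{1/n})=\exp\{-\ell(-\log u_1,\dots,-\log u_d)\}\quad\text{for all }u\in[0,1]^d$$ (the right-hand side being $0$ if some $u_j=0$), and $$\lim_{n\to\infty}n\{1-C(1-w_1/n,\dots,1-w_d/n)\}=\ell(w_1,\dots,w_d)\quad\text{for all }w\in[0,\infty)^d.$$ (2) The extreme-value limit is a moving-maximum max-stable process: let $\{(\xi_i,s_i^*)\}$ be the points of a Poisson process on $(0,\infty)\times\mathbb{R}^2$ with intensity $\xi^{-2}\,d\xi\times ds^*$, and $Z_{\mathrm{EV}}(s_j)=\sup_i\xi_i\,\zeta(s_j,s_i^*)$. Then for all $z_1,\dots,z_d>0$, $$\Pr\{Z_{\mathrm{EV}}(s_j)\le z_j\ \forall j\}=\exp\{-\ell(1/z_1,\dots,1/z_d)\},$$ $$\lim_{n\to\infty}\Pr\Big\{Z(s_j)\le \tfrac{n}{\pi}\Big(\int_{\mathbb{R}^2} k(s_j,x)\,dx\Big) z_j\ \forall j\Big\}^n=\Pr\{Z_{\mathrm{EV}}(s_j)\le z_j\ \forall j\},$$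 so that the componentwise maxima of $n$ independent copies of $(Z(s_1),\dots,Z(s_d))$, divided by $n\int k(s_j,x)\,dx/\pi$, converge in distribution to $(Z_{\mathrm{EV}}(s_1),\dots,Z_{\mathrm{EV}}(s_d))$; and $\Pr\{Z_{\mathrm{EV}}(s_j)\le n z_j\ \forall j\}^n=\Pr\{Z_{\mathrm{EV}}(s_j)\le z_j\ \forall j\}$ for every integer $n\ge1$. -/

import Mathlib

open MeasureTheory ProbabilityTheory Filter Set Topology
open scoped ENNReal NNReal

noncomputable section

namespace CauchyConv

/-- The plane `ℝ²` with its Euclidean structure and Lebesgue measure. -/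
abbrev Plane : Type := EuclideanSpace ℝ (Fin 2)

/-- `W` is a Cauchy white noise on the plane (an independently scattered, `σ`-additive symmetric
Cauchy random measure with Lebesgue control measure), defined on the probability space `(Ω, P)`.
Only the values of `W` at Borel sets of finite area are meaningful. -/
structure IsCauchyWhiteNoise {Ω : Type*} [MeasurableSpace Ω] (P : Measure Ω)
    (W : Set Plane → Ω → ℝ) : Prop where
  /-- Each `W A` is a random variable. -/
  measurable : ∀ A : Set Plane, MeasurableSet A → volume A < ∞ → Measurable (W A)
  /-- `W A` has the Cauchy distribution with location `0` and scale the area of `A`. -/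
  law : ∀ A : Set Plane, MeasurableSet A → volume A < ∞ →
    P.map (W A) = cauchyMeasure 0 (volume A).toNNReal
  /-- The values at disjoint sets are independent. -/
  indep : ∀ A : ℕ → Set Plane, (∀ i, MeasurableSet (A i)) → (∀ i, volume (A i) < ∞) →
    Pairwise (Function.onFun Disjoint A) → iIndepFun (fun i => W (A i)) P
  /-- Almost sure countable additivity. The series need not converge absolutely, so this is
  convergence of the partial sums. -/
  additive : ∀ A : ℕ → Set Plane, (∀ i, MeasurableSet (A i)) → volume (⋃ i, A i) < ∞ →
    Pairwise (Function.onFun Disjoint A) →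
    ∀ᵐ ω ∂P, Tendsto (fun n : ℕ => ∑ i ∈ Finset.range n, W (A i) ω) atTop (𝓝 (W (⋃ i, A i) ω))

/-- The integral `∑_y y W(φ = y)` of a simple function `φ`. The value `y = 0` contributes `0`. -/
def simpleIntegral {Ω : Type*} (W : Set Plane → Ω → ℝ) (φ : SimpleFunc Plane ℝ) (ω : Ω) : ℝ :=
  ∑ y ∈ φ.range, y * W (φ ⁻¹' {y}) ω

/-- The random variable `X` is (a version of) the stochastic integral `∫ f(s*) W(ds*)`: it is the
limit in probability of the integrals of integrable simple functions which converge to `f`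
in `L¹`. -/
def IsStochasticIntegral {Ω : Type*} [MeasurableSpace Ω] (P : Measure Ω)
    (W : Set Plane → Ω → ℝ) (f : Plane → ℝ) (X : Ω → ℝ) : Prop :=
  AEMeasurable X P ∧
    ∃ φ : ℕ → SimpleFunc Plane ℝ,
      (∀ n, Integrable (φ n) volume) ∧
      Tendsto (fun n => ∫⁻ x, ‖φ n x - f x‖ₑ) atTop (𝓝 0) ∧
      TendstoInMeasure P (fun n => simpleIntegral W (φ n)) atTop X

/-- `Z` is the convolution process `Z(s) = ∫ k(s, s*) W(ds*)`. -/
def IsConvolutionProcess {Ω : Type*} [MeasurableSpace Ω] (P : Measure Ω)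
    (W : Set Plane → Ω → ℝ) (k : Plane → Plane → ℝ) (Z : Plane → Ω → ℝ) : Prop :=
  ∀ s, IsStochasticIntegral P W (k s) (Z s)

/-- The normalized kernel `ζ(s, x) = k(s, x) / ∫ k(s, s*) ds*`. -/
def normalizedKernel (k : Plane → Plane → ℝ) (s x : Plane) : ℝ :=
  k s x / ∫ y, k s y

/-- The function `∫ max_j w_j ζ(s_j, x) dx` of `w`, for the sites `s_1, …, s_d`. -/
def maxIntegral (k : Plane → Plane → ℝ) {d : ℕ} (s : Fin d → Plane) (w : Fin d → ℝ) : ℝ :=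
  ∫ x, ⨆ j, w j * normalizedKernel k (s j) x

/-- The copula of a random vector `X` with continuous margins `F_1, …, F_d`: the joint distribution
function of `(F_1(X_1), …, F_d(X_d))`. -/
def copula {Ω : Type*} [MeasurableSpace Ω] (P : Measure Ω) {d : ℕ} (X : Fin d → Ω → ℝ)
    (u : Fin d → ℝ) : ℝ :=
  P.real {ω | ∀ j, cdf (P.map (X j)) (X j ω) ≤ u j}

/-- The extreme-value copula `exp{-ℓ(-log u_1, …, -log u_d)}` on `[0, 1]^d`; its value is
`exp(-∞) = 0` when some `u_j` is `0`. -/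
def evCopula {d : ℕ} (ℓ : (Fin d → ℝ) → ℝ) (u : Fin d → ℝ) : ℝ :=
  open Classical in if ∀ j, 0 < u j then Real.exp (-ℓ fun j => -Real.log (u j)) else 0

/-- `ℓ` is, on `[0, ∞)^d`, the stable (upper) tail dependence function of a random vector with
copula `C`: the limit of `C^n(u_1^{1/n}, …, u_d^{1/n})` is the extreme-value copula given
by `ℓ`, and `ℓ(w) = lim n {1 - C(1 - w_1/n, …, 1 - w_d/n)}`. -/
def IsStableTailDependenceFunction {d : ℕ} (C : (Fin d → ℝ) → ℝ) (ℓ : (Fin d → ℝ) → ℝ) : Prop :=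
  (∀ u : Fin d → ℝ, (∀ j, u j ∈ Icc (0 : ℝ) 1) →
    Tendsto (fun n : ℕ => C (fun j => u j ^ (1 / (n : ℝ))) ^ n) atTop (𝓝 (evCopula ℓ u))) ∧
  (∀ w : Fin d → ℝ, (∀ j, 0 ≤ w j) →
    Tendsto (fun n : ℕ => (n : ℝ) * (1 - C fun j => 1 - w j / (n : ℝ))) atTop (𝓝 (ℓ w)))

/-- The number of points `T_i` in the set `A`. -/
def pointCount {Ω S : Type*} (T : ℕ → Ω → S) (A : Set S) (ω : Ω) : ℕ∞ :=
  {i | T i ω ∈ A}.encard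

/-- The random points `T_0, T_1, …` form a Poisson process with (infinite, `σ`-finite) intensity
measure `ν`. -/
structure IsPoissonProcess {Ω S : Type*} [MeasurableSpace Ω] [MeasurableSpace S] (P : Measure Ω)
    (ν : Measure S) (T : ℕ → Ω → S) : Prop where
  measurable : ∀ i, Measurable (T i)
  /-- The number of points in a set of finite intensity has a Poisson distribution. -/
  law : ∀ A : Set S, MeasurableSet A → ν A < ∞ → ∀ n : ℕ,
    P {ω | pointCount T A ω = n} =
      ENNReal.ofReal (Real.exp (-(ν A).toReal) * (ν A).toReal ^ n / (n.factorial : ℝ))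
  /-- The numbers of points in disjoint sets are independent. -/
  indep : ∀ A : ℕ → Set S, (∀ i, MeasurableSet (A i)) →
    Pairwise (Function.onFun Disjoint A) → iIndepFun (fun i => pointCount T (A i)) P

/-- The measure `ξ⁻² dξ × ds*` on `(0, ∞) × ℝ²`. -/
def maxIntensity : Measure (ℝ × Plane) :=
  ((volume.restrict (Ioi (0 : ℝ))).withDensity fun ξ => ENNReal.ofReal (ξ ^ 2)⁻¹).prod volume

/-- The moving maximum process `Z_EV(s) = sup_i ξ_i ζ(s, s_i*)` driven by the points
`T_i = (ξ_i, s_i*)`, with values in `[0, ∞]`. -/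
def movingMaximum {Ω : Type*} (ζ : Plane → Plane → ℝ) (T : ℕ → Ω → ℝ × Plane) (s : Plane)
    (ω : Ω) : ℝ≥0∞ :=
  ⨆ i, ENNReal.ofReal ((T i ω).1 * ζ s (T i ω).2)

end CauchyConv

end

namespace CauchyConv

/-! Everything rests on one tail limit: for nonnegative integrable `f j` with stochastic integrals
`X j`, the quantity `n * P(∃ j, n < X j)` tends to `(1/π) ∫ max_j f j`. For simple integrands, cut
along a common partition, the `X j` are nonnegative combinations of independent Cauchy variables. An
exceedance is then asymptotically due to a single large variable (`tendsto_mul_real_exists_lt_sum`),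
and a cell of area `a` with values `v j` contributes `a * max_j v j / π`. General integrands follow
by L¹ approximation: the error is again a stochastic integral, so it is Cauchy with scale its L¹
norm (`IsStochasticIntegral.map_eq`), and its tail at level `t` is at most that norm divided by `t`.
The integral of the maximum is Lipschitz in L¹ as well.

The copula limits are this tail limit with thresholds depending on `n`. Inverting the Cauchy
distribution function turns the event `1 - v/n < F(Z)` into `n < b n * Z` with `b n → π w / ∫ k`
when `v → w`; the choices `v = w` and `v = n (1 - u^(1/n))` give the two limits
(`tendsto_mul_one_sub_copula`). Powers of distribution functions converge by `(1 - c/n)^n →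
exp(-c)`.

On the Poisson side, the moving maximum stays below `z` exactly when no point falls in `{∃ j, z j <
ξ ζ(s j, x)}`. Integrating out `ξ` first gives this region the intensity `∫ max_j ζ(s j, x) / z j
dx`. Max-stability is the homogeneity of `ℓ`. -/

/-! ### The Cauchy distribution: tails, scaling, symmetry. -/

lemma cauchyMeasure_real_Iic {γ : ℝ≥0} (hγ : γ ≠ 0) (x : ℝ) :
    (cauchyMeasure 0 γ).real (Iic x) = 1 / 2 + Real.arctan (x / γ) / Real.pi := by
  have hγ' : (0 : ℝ) < γ := by positivity
  rw [cauchyMeasure_of_scale_ne_zero _ hγ, measureReal_def, withDensity_apply _ measurableSet_Iic]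
  simp only [cauchyPDF]
  rw [← integral_eq_lintegral_of_nonneg_ae
    (ae_of_all _ fun x ↦ (cauchyPDF_pos 0 hγ x).le) (by fun_prop)]
  simp only [cauchyPDFReal_def', sub_zero]
  have hderiv : ∀ y ∈ Iic x, HasDerivAt (fun y : ℝ => γ * Real.arctan (y / γ))
      ((1 + (y / γ) ^ 2)⁻¹) y := by
    intro y _
    have := (((hasDerivAt_id y).div_const (γ : ℝ)).arctan).const_mul (γ : ℝ)
    convert! this using 1
    simp
    field_simp
  have hlim : Tendsto (fun y : ℝ => γ * Real.arctan (y / γ)) atBot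
      (𝓝 (γ * (-(Real.pi / 2)))) :=
    (((tendsto_nhds_of_tendsto_nhdsWithin Real.tendsto_arctan_atBot).comp
      (tendsto_id.atBot_div_const hγ')).const_mul _)
  have hint : Integrable (fun y : ℝ => (1 + (y / γ) ^ 2)⁻¹) :=
    integrable_inv_one_add_sq.comp_div hγ'.ne'
  rw [integral_const_mul,
    integral_Iic_of_hasDerivAt_of_tendsto' hderiv hint.integrableOn hlim]
  have := Real.pi_pos
  push_cast
  field_simp
  ring

lemma nullSingletonClass_cauchyMeasure {γ : ℝ≥0} (hγ : γ ≠ 0) :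
    NullSingletonClass (cauchyMeasure 0 γ) := by
  rw [cauchyMeasure_of_scale_ne_zero _ hγ]; infer_instance

/-- The upper tail of the Cauchy distribution. -/
lemma cauchyMeasure_real_Ioi (γ : ℝ≥0) {x : ℝ} (hx : 0 < x) :
    (cauchyMeasure 0 γ).real (Ioi x) = Real.arctan (γ / x) / Real.pi := by
  by_cases hγ : γ = 0
  · subst hγ
    simp [measureReal_def, hx.le]
  · have hγ' : (0 : ℝ) < γ := by positivity
    have h1 : (cauchyMeasure 0 γ).real (Ioi x) = 1 - (cauchyMeasure 0 γ).real (Iic x) := by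
      rw [← compl_Iic, probReal_compl_eq_one_sub measurableSet_Iic]
    have h2 := Real.arctan_inv_of_pos (div_pos hγ' hx)
    rw [inv_div] at h2
    rw [h1, cauchyMeasure_real_Iic hγ, h2]
    have := Real.pi_pos
    field_simp
    ring

lemma cauchyMeasure_map_neg (γ : ℝ≥0) :
    (cauchyMeasure 0 γ).map (fun x => -x) = cauchyMeasure 0 γ := by
  by_cases hγ : γ = 0
  · subst hγ
    simp [Measure.map_dirac' (f := fun x : ℝ => -x) (by fun_prop)]
  have := nullSingletonClass_cauchyMeasure hγ
  have : IsProbabilityMeasure ((cauchyMeasure 0 γ).map (fun x => -x)) :=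
    Measure.isProbabilityMeasure_map (by fun_prop)
  refine Measure.eq_of_cdf _ _ (StieltjesFunction.ext fun x => ?_)
  rw [cdf_eq_real, cdf_eq_real, map_measureReal_apply (by fun_prop) measurableSet_Iic]
  have h1 : (fun x : ℝ => -x) ⁻¹' Iic x = Ici (-x) := by ext y; simp
  have h2 : (cauchyMeasure 0 γ).real (Ici (-x)) = (cauchyMeasure 0 γ).real (Ioi (-x)) :=
    measureReal_congr Ioi_ae_eq_Ici.symm
  rw [h1, h2, ← compl_Iic, probReal_compl_eq_one_sub measurableSet_Iic,
    cauchyMeasure_real_Iic hγ, cauchyMeasure_real_Iic hγ, neg_div, Real.arctan_neg]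
  ring

lemma cauchyMeasure_map_const_mul (γ : ℝ≥0) (c : ℝ) :
    (cauchyMeasure 0 γ).map (fun x => c * x) = cauchyMeasure 0 (‖c‖₊ * γ) := by
  have hpos : ∀ c : ℝ, 0 < c →
      (cauchyMeasure 0 γ).map (fun x => c * x) = cauchyMeasure 0 (‖c‖₊ * γ) := by
    intro c hc
    by_cases hγ : γ = 0
    · subst hγ
      simp [Measure.map_dirac' (f := fun x : ℝ => c * x) (by fun_prop)]
    have : IsProbabilityMeasure ((cauchyMeasure 0 γ).map (fun x => c * x)) :=
      Measure.isProbabilityMeasure_map (by fun_prop)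
    refine Measure.eq_of_cdf _ _ (StieltjesFunction.ext fun x => ?_)
    rw [cdf_eq_real, cdf_eq_real, map_measureReal_apply (by fun_prop) measurableSet_Iic]
    have h1 : (fun x : ℝ => c * x) ⁻¹' Iic x = Iic (x / c) := by
      ext y; simp [le_div_iff₀ hc, mul_comm]
    have hcγ : ‖c‖₊ * γ ≠ 0 := mul_ne_zero (by simpa using hc.ne') hγ
    rw [h1, cauchyMeasure_real_Iic hγ, cauchyMeasure_real_Iic hcγ]
    simp [abs_of_pos hc, div_div]
  rcases lt_trichotomy c 0 with hc | rfl | hc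
  · have h := hpos (-c) (by linarith)
    have h2 : (fun x : ℝ => c * x) = (fun x => -x) ∘ (fun x => -c * x) := by ext; simp
    rw [h2, ← Measure.map_map (by fun_prop) (by fun_prop), h, cauchyMeasure_map_neg]
    simp
  · simp
  · exact hpos c hc

/-- Moving the scale into the argument makes continuity in the scale a case of continuity of one
characteristic function; its closed form is never needed. -/
lemma charFun_cauchyMeasure (γ : ℝ≥0) (t : ℝ) :
    charFun (cauchyMeasure 0 γ) t = charFun (cauchyMeasure 0 1) (γ * t) := by
  have h := cauchyMeasure_map_const_mul 1 γ
  rw [NNReal.nnnorm_eq, mul_one] at h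
  rw [← charFun_map_mul]
  exact congrArg (fun μ => charFun μ t) h.symm

lemma real_lt_of_map_eq_cauchyMeasure {Ω : Type*} [MeasurableSpace Ω] {P : Measure Ω}
    {X : Ω → ℝ} (hX : AEMeasurable X P) {γ : ℝ≥0}
    (h : P.map X = cauchyMeasure 0 γ) {t : ℝ} (ht : 0 < t) :
    P.real {ω | t < X ω} = Real.arctan (γ / t) / Real.pi := by
  rw [← cauchyMeasure_real_Ioi γ ht, ← h, measureReal_def, measureReal_def,
    Measure.map_apply_of_aemeasurable hX measurableSet_Ioi]
  rfl

lemma arctan_le_self {x : ℝ} (hx : 0 ≤ x) : Real.arctan x ≤ x := by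
  have h := Real.le_tan (Real.arctan_nonneg.2 hx) (Real.arctan_lt_pi_div_two x)
  rwa [Real.tan_arctan] at h

/-- A substitute for Markov's inequality, as the mean does not exist. Linearity in the scale is what
later turns L¹ errors into probability bounds of order `1/n`. -/
lemma real_lt_abs_le_of_map_eq_cauchyMeasure {Ω : Type*} [MeasurableSpace Ω] {P : Measure Ω}
    [IsProbabilityMeasure P]
    {X : Ω → ℝ} (hX : AEMeasurable X P) {γ : ℝ≥0}
    (h : P.map X = cauchyMeasure 0 γ) {t : ℝ} (ht : 0 < t) :
    P.real {ω | t < |X ω|} ≤ γ / t := by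
  have h' : P.map (fun ω => -X ω) = cauchyMeasure 0 γ := by
    have := AEMeasurable.map_map_of_aemeasurable (μ := P) (g := fun x : ℝ => -x) (f := X)
      (by fun_prop) hX
    rw [h, cauchyMeasure_map_neg] at this
    exact this.symm
  have h1 : {ω | t < |X ω|} = {ω | t < X ω} ∪ {ω | t < -X ω} := by
    ext ω; simp [lt_abs]
  rw [h1]
  refine (measureReal_union_le _ _).trans ?_
  rw [real_lt_of_map_eq_cauchyMeasure hX h ht,
    real_lt_of_map_eq_cauchyMeasure (X := fun ω => -X ω) hX.neg h' ht]
  have hγ : (0 : ℝ) ≤ γ / t := by positivity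
  have h2 := arctan_le_self hγ
  have h3 : Real.arctan (γ / t) / Real.pi ≤ (γ / t) / 2 := by
    have := Real.pi_gt_three
    exact div_le_div₀ hγ h2 (by norm_num) (by linarith)
  linarith

/-- The tail of a Cauchy distribution is regularly varying. -/
lemma tendsto_mul_arctan_div (c : ℝ) :
    Tendsto (fun n : ℕ => (n : ℝ) * (Real.arctan (c / n) / Real.pi)) atTop
      (𝓝 (c / Real.pi)) := by
  have h1 : HasDerivAt (fun x => Real.arctan (c * x)) c 0 := by
    have := ((hasDerivAt_id (0 : ℝ)).const_mul c).arctan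
    simpa using this
  have h2 : Tendsto (fun n : ℕ => ((n : ℝ))⁻¹) atTop (𝓝[≠] 0) :=
    tendsto_nhdsWithin_iff.2 ⟨tendsto_inv_atTop_nhds_zero_nat,
      (eventually_ge_atTop 1).mono fun n hn => by simp; omega⟩
  have h3 := (h1.tendsto_slope.comp h2).div_const Real.pi
  refine h3.congr fun n => ?_
  simp [slope_def_field, div_eq_mul_inv]
  ring

/-- A sandwich in which the bounds depend on `ε` and their limits only come within `ε` of `L`. -/
lemma tendsto_of_forall_approx {x : ℕ → ℝ} {L : ℝ}
    (h : ∀ ε > 0, ∃ (l u : ℕ → ℝ) (a b : ℝ), Tendsto l atTop (𝓝 a) ∧ Tendsto u atTop (𝓝 b) ∧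
      L - ε ≤ a ∧ b ≤ L + ε ∧ ∀ᶠ n in atTop, l n ≤ x n ∧ x n ≤ u n) :
    Tendsto x atTop (𝓝 L) := by
  rw [tendsto_order]
  constructor
  · intro c hc
    obtain ⟨l, u, a, b, hl, -, ha, -, hx⟩ := h ((L - c) / 2) (by linarith)
    filter_upwards [hl.eventually (lt_mem_nhds (show c < a by linarith)), hx] with n h1 h2
    linarith
  · intro c hc
    obtain ⟨l, u, a, b, -, hu, -, hb, hx⟩ := h ((c - L) / 2) (by linarith)
    filter_upwards [hu.eventually (gt_mem_nhds (show b < c by linarith)), hx] with n h1 h2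
    linarith

/-! ### Finite suprema and their integrals. -/

section Sup

variable {κ : Type*} [Fintype κ]

/-- This is where the maximum in `ℓ` comes from: one common jump `y` exceeds the level in some
coordinate as soon as it does so in the coordinate with the largest coefficient. With `t ≥ 0`, both
sides fail when `y ≤ 0`, and also for empty `κ`, where the real supremum is `0`. -/
lemma exists_lt_mul_iff_lt_iSup_mul (a : κ → ℝ) {t : ℝ} (ht : 0 ≤ t) {y : ℝ}
    (ha : ∀ j, 0 ≤ a j) : (∃ j, t < a j * y) ↔ t < (⨆ j, a j) * y := by
  rcases isEmpty_or_nonempty κ with hκ | hκ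
  · simp [ht]
  rcases le_or_gt y 0 with hy | hy
  · have h1 : ∀ b : ℝ, 0 ≤ b → ¬ t < b * y := fun b hb =>
      not_lt.2 ((mul_nonpos_of_nonneg_of_nonpos hb hy).trans ht)
    simp [h1 _ (ha _), h1 _ (Real.iSup_nonneg ha)]
  · simp_rw [← div_lt_iff₀ hy]
    exact (lt_ciSup_iff (Finite.bddAbove_range a)).symm

lemma abs_iSup_sub_iSup_le (a b : κ → ℝ) :
    |(⨆ j, a j) - ⨆ j, b j| ≤ ∑ j, |a j - b j| := by
  rcases isEmpty_or_nonempty κ with hκ | hκ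
  · simp [Real.iSup_of_isEmpty]
  have key : ∀ a b : κ → ℝ, (⨆ j, a j) ≤ (⨆ j, b j) + ∑ j, |a j - b j| := by
    intro a b
    refine ciSup_le fun j => ?_
    have h1 := le_ciSup (Finite.bddAbove_range b) j
    have h2 := Finset.single_le_sum (f := fun j => |a j - b j|) (fun i _ => abs_nonneg _)
      (Finset.mem_univ j)
    have h3 := le_abs_self (a j - b j)
    linarith
  have h1 := key a b
  have h2 := key b a
  simp_rw [abs_sub_comm (b _) (a _)] at h2
  rw [abs_le]
  constructor <;> linarith

lemma integrable_iSup {α : Type*} [MeasurableSpace α] {μ : Measure α} {f : κ → α → ℝ}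
    (hf : ∀ j, Integrable (f j) μ) : Integrable (fun x => ⨆ j, f j x) μ := by
  refine (integrable_finsetSum Finset.univ fun j _ => (hf j).abs).mono'
    (AEMeasurable.iSup fun j => (hf j).aemeasurable).aestronglyMeasurable
    (ae_of_all _ fun x => ?_)
  have := abs_iSup_sub_iSup_le (fun j => f j x) (fun _ => 0)
  have h0 : (⨆ _ : κ, (0 : ℝ)) = 0 := by
    rcases isEmpty_or_nonempty κ with hκ | hκ <;> simp
  simpa [h0] using this

lemma abs_integral_iSup_sub_le {α : Type*} [MeasurableSpace α] {μ : Measure α} {f g : κ → α → ℝ}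
    (hf : ∀ j, Integrable (f j) μ) (hg : ∀ j, Integrable (g j) μ) :
    |(∫ x, ⨆ j, f j x ∂μ) - ∫ x, ⨆ j, g j x ∂μ| ≤ ∑ j, ∫ x, |f j x - g j x| ∂μ := by
  rw [← integral_sub (integrable_iSup hf) (integrable_iSup hg),
    ← integral_finsetSum (f := fun j x => |f j x - g j x|) _
      fun j _ => ((hf j).sub (hg j)).abs]
  refine (abs_integral_le_integral_abs).trans ?_
  refine integral_mono ((integrable_iSup hf).sub (integrable_iSup hg)).abs
    (integrable_finsetSum _ fun j _ => ((hf j).sub (hg j)).abs) fun x => ?_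
  exact abs_iSup_sub_iSup_le _ _

end Sup

/-! ### Laws of simple and stochastic integrals. -/

section WhiteNoise

variable {Ω : Type*} [MeasurableSpace Ω] {P : Measure Ω}
  {W : Set Plane → Ω → ℝ}

lemma IsCauchyWhiteNoise.ae_empty (hW : IsCauchyWhiteNoise P W) : W ∅ =ᵐ[P] 0 := by
  have h := hW.law ∅ MeasurableSet.empty (by simp)
  have hm := hW.measurable ∅ MeasurableSet.empty (by simp)
  have h0 : (P.map (W ∅)) {0}ᶜ = 0 := by rw [h]; simp
  rw [Measure.map_apply hm (measurableSet_singleton 0).compl] at h0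
  exact h0

lemma IsCauchyWhiteNoise.ae_union (hW : IsCauchyWhiteNoise P W) {A B : Set Plane}
    (hA : MeasurableSet A) (hB : MeasurableSet B) (hA' : volume A < ∞) (hB' : volume B < ∞)
    (hAB : Disjoint A B) : W (A ∪ B) =ᵐ[P] fun ω => W A ω + W B ω := by
  let C : ℕ → Set Plane := fun n => match n with
    | 0 => A
    | 1 => B
    | _ => ∅
  have hU : ⋃ n, C n = A ∪ B := by
    ext x
    simp only [mem_iUnion, mem_union]
    constructor
    · rintro ⟨_ | _ | n, hn⟩
      · exact Or.inl hn
      · exact Or.inr hn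
      · exact hn.elim
    · rintro (h | h)
      · exact ⟨0, h⟩
      · exact ⟨1, h⟩
  have hC : ∀ n, MeasurableSet (C n) := by
    rintro (_ | _ | n)
    exacts [hA, hB, MeasurableSet.empty]
  have hd : Pairwise (Function.onFun Disjoint C) := by
    rintro (_ | _ | m) (_ | _ | n) hmn
    all_goals first
      | exact absurd rfl hmn
      | exact hAB
      | exact hAB.symm
      | exact disjoint_bot_left
      | exact disjoint_bot_right
  have h := hW.additive C hC (by rw [hU]; exact measure_union_lt_top hA' hB') hd
  filter_upwards [h, hW.ae_empty] with ω h1 h2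
  rw [hU] at h1
  refine tendsto_nhds_unique h1 (tendsto_const_nhds.congr' ?_)
  filter_upwards [eventually_ge_atTop 2] with n hn
  obtain ⟨m, rfl⟩ := Nat.exists_eq_add_of_le' hn
  rw [Finset.sum_range_succ', Finset.sum_range_succ']
  have h3 : ∀ i, W (C (i + 1 + 1)) ω = 0 := fun i => h2
  simp only [h3, Finset.sum_const_zero, zero_add]
  exact add_comm _ _

lemma IsCauchyWhiteNoise.ae_biUnion (hW : IsCauchyWhiteNoise P W) {ι : Type*} (s : Finset ι)
    {A : ι → Set Plane} (hA : ∀ i ∈ s, MeasurableSet (A i)) (hA' : ∀ i ∈ s, volume (A i) < ∞)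
    (hd : (s : Set ι).PairwiseDisjoint A) :
    W (⋃ i ∈ s, A i) =ᵐ[P] fun ω => ∑ i ∈ s, W (A i) ω := by
  classical
  induction s using Finset.induction_on with
  | empty => simpa [EventuallyEq] using hW.ae_empty
  | insert a s ha ih =>
    have h1 := ih (fun i hi => hA i (Finset.mem_insert_of_mem hi))
      (fun i hi => hA' i (Finset.mem_insert_of_mem hi))
      (hd.subset (by simp))
    have h2 := hW.ae_union (A := A a) (B := ⋃ i ∈ s, A i) (hA a (by simp))
      (s.measurableSet_biUnion fun i hi => hA i (Finset.mem_insert_of_mem hi))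
      (hA' a (by simp))
      ((measure_biUnion_lt_top s.finite_toSet fun i hi => hA' i (Finset.mem_insert_of_mem hi)))
      (by
        rw [disjoint_iUnion₂_right]
        intro i hi
        exact hd (by simp) (by simp [hi]) (fun h => ha (h ▸ hi)))
    filter_upwards [h1, h2] with ω h1 h2
    rw [Finset.set_biUnion_insert, h2, Finset.sum_insert ha, h1]

lemma IsCauchyWhiteNoise.iIndepFun (hW : IsCauchyWhiteNoise P W) {ι : Type*} [Fintype ι]
    {A : ι → Set Plane} (hA : ∀ i, MeasurableSet (A i)) (hA' : ∀ i, volume (A i) < ∞)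
    (hd : Pairwise (Function.onFun Disjoint A)) :
    ProbabilityTheory.iIndepFun (fun i => W (A i)) P := by
  let e := Fintype.equivFin ι
  let B : ℕ → Set Plane := fun n =>
    if h : n < Fintype.card ι then A (e.symm ⟨n, h⟩) else ∅
  have hBA : ∀ i, B (e i) = A i := fun i => by simp [B]
  have h := hW.indep B
    (fun n => by by_cases h : n < Fintype.card ι <;> simp [B, h, hA])
    (fun n => by by_cases h : n < Fintype.card ι <;> simp [B, h, hA'])
    (fun m n hmn => by
      by_cases hm : m < Fintype.card ι
      · by_cases hn : n < Fintype.card ι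
        · simp only [Function.onFun, B, hm, hn, dite_true]
          exact hd (fun h => hmn (by simpa using h))
        · simp [Function.onFun, B, hn]
      · simp [Function.onFun, B, hm])
  have h2 := h.precomp (g := fun i => (e i : ℕ)) (fun i j hij => e.injective (Fin.ext hij))
  simpa only [hBA] using h2

/-- Adjacent rectangles of height one; they realise any two scales by independent values of the
noise. -/
lemma exists_disjoint_volume_eq (a b : ℝ≥0) : ∃ A B : Set Plane, MeasurableSet A ∧
    MeasurableSet B ∧ volume A = a ∧ volume B = b ∧ Disjoint A B := by
  let S : ℝ → ℝ → Set Plane := fun u v =>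
    (WithLp.ofLp : Plane → Fin 2 → ℝ) ⁻¹' (univ.pi ![Ioc u v, Ioc 0 1])
  have hp := PiLp.volume_preserving_ofLp (Fin 2)
  have hm' : ∀ u v, MeasurableSet (univ.pi ![Ioc u v, Ioc (0 : ℝ) 1]) := fun u v =>
    MeasurableSet.univ_pi fun i => by fin_cases i <;> simp
  have hm : ∀ u v, MeasurableSet (S u v) := fun u v => hp.measurable (hm' u v)
  have hv : ∀ u v, volume (S u v) = ENNReal.ofReal (v - u) := fun u v => by
    rw [hp.measure_preimage (hm' u v).nullMeasurableSet, volume_pi_pi]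
    simp
  refine ⟨S 0 a, S a (a + b), hm _ _, hm _ _, by simp [hv], by simp [hv], ?_⟩
  refine Disjoint.preimage _ (disjoint_left.2 fun x h1 h2 => ?_)
  have h1 := h1 0 (mem_univ _)
  have h2 := h2 0 (mem_univ _)
  simp only [Matrix.cons_val_zero, mem_Ioc] at h1 h2
  linarith

lemma map_const_mul_of_map_eq_cauchyMeasure {X : Ω → ℝ} (hX : AEMeasurable X P) {γ : ℝ≥0}
    (h : P.map X = cauchyMeasure 0 γ) (c : ℝ) :
    P.map (fun ω => c * X ω) = cauchyMeasure 0 (‖c‖₊ * γ) := by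
  have := AEMeasurable.map_map_of_aemeasurable (μ := P) (g := fun x : ℝ => c * x) (f := X)
    (by fun_prop) hX
  rw [h, cauchyMeasure_map_const_mul] at this
  exact this.symm

lemma simpleIntegral_eq_sum_filter {Ω : Type*} (W : Set Plane → Ω → ℝ) (φ : SimpleFunc Plane ℝ) :
    simpleIntegral W φ = fun ω => ∑ y : {y // y ∈ φ.range.filter (· ≠ 0)},
      (y : ℝ) * W (φ ⁻¹' {(y : ℝ)}) ω := by
  ext ω
  rw [Finset.sum_coe_sort (φ.range.filter (· ≠ 0)) (fun y => y * W (φ ⁻¹' {y}) ω),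
    simpleIntegral]
  refine (Finset.sum_filter_of_ne fun y _ hy => left_ne_zero_of_mul hy).symm

lemma IsCauchyWhiteNoise.measurable_simpleIntegral (hW : IsCauchyWhiteNoise P W)
    {φ : SimpleFunc Plane ℝ} (hφ : Integrable φ volume) : Measurable (simpleIntegral W φ) := by
  rw [simpleIntegral_eq_sum_filter]
  refine Finset.measurable_fun_sum _ fun y _ => (hW.measurable _ (φ.measurableSet_fiber _)
    ?_).const_mul _
  exact SimpleFunc.measure_preimage_lt_top_of_integrable φ hφ (Finset.mem_filter.1 y.2).2

/-- Additivity of `W` lets an integral be computed on a finer partition. Applied to a common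
refinement, it gives linearity and puts several integrands on the same cells. -/
lemma IsCauchyWhiteNoise.simpleIntegral_map (hW : IsCauchyWhiteNoise P W) {α : Type*}
    (Φ : SimpleFunc Plane α) (g : α → ℝ)
    (hΦ : ∀ v ∈ Φ.range, g v ≠ 0 → volume (Φ ⁻¹' {v}) < ∞) :
    simpleIntegral W (Φ.map g) =ᵐ[P] fun ω => ∑ v ∈ Φ.range, g v * W (Φ ⁻¹' {v}) ω := by
  classical
  have h : ∀ y ∈ (Φ.map g).range, ∀ᵐ ω ∂P,
      y * W ((Φ.map g) ⁻¹' {y}) ω = ∑ v ∈ Φ.range with g v = y, y * W (Φ ⁻¹' {v}) ω := by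
    intro y _
    -- The zero level set may have infinite area, where `W` is uncontrolled, but its coefficient
    -- vanishes.
    rcases eq_or_ne y 0 with rfl | hy
    · simp
    have h1 := hW.ae_biUnion (Φ.range.filter fun v => g v = y) (A := fun v => Φ ⁻¹' {v})
      (fun v _ => Φ.measurableSet_fiber v)
      (fun v hv => hΦ v (Finset.mem_filter.1 hv).1 (by rw [(Finset.mem_filter.1 hv).2]; exact hy))
      (fun u _ v _ huv => Disjoint.preimage _ (by simpa using huv))
    have h2 : ⋃ v ∈ Φ.range.filter fun v => g v = y, Φ ⁻¹' {v} = (Φ.map g) ⁻¹' {y} := by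
      ext x; simp
    rw [h2] at h1
    filter_upwards [h1] with ω h1
    rw [h1, Finset.mul_sum]
  filter_upwards [(Filter.eventually_all_finset _).2 h] with ω hω
  rw [simpleIntegral, Finset.sum_congr rfl hω, SimpleFunc.range_map]
  rw [Finset.sum_image' (h := fun v => g v * W (Φ ⁻¹' {v}) ω)]
  intro v _
  refine Finset.sum_congr rfl fun u hu => ?_
  rw [(Finset.mem_filter.1 hu).2]

lemma IsCauchyWhiteNoise.simpleIntegral_sub (hW : IsCauchyWhiteNoise P W)
    {φ ψ : SimpleFunc Plane ℝ} (hφ : Integrable φ volume) (hψ : Integrable ψ volume) :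
    simpleIntegral W (φ - ψ) =ᵐ[P] fun ω => simpleIntegral W φ ω - simpleIntegral W ψ ω := by
  have hfin : ∀ v : ℝ × ℝ, v ≠ 0 → volume (φ.pair ψ ⁻¹' {v}) < ∞ := by
    rintro ⟨a, b⟩ hv
    by_cases ha : a = 0
    · refine (measure_mono ?_).trans_lt
        (SimpleFunc.measure_preimage_lt_top_of_integrable ψ hψ (x := b)
          (fun hb => hv (by simp [ha, hb])))
      intro x hx
      simp only [mem_preimage, SimpleFunc.pair_apply, mem_singleton_iff, Prod.mk.injEq] at hx
      exact hx.2
    · refine (measure_mono ?_).trans_lt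
        (SimpleFunc.measure_preimage_lt_top_of_integrable φ hφ ha)
      intro x hx
      simp only [mem_preimage, SimpleFunc.pair_apply, mem_singleton_iff, Prod.mk.injEq] at hx
      exact hx.1
  have h1 := hW.simpleIntegral_map (φ.pair ψ) Prod.fst
    (fun v _ hv => hfin v (by rintro rfl; simp at hv))
  have h2 := hW.simpleIntegral_map (φ.pair ψ) Prod.snd
    (fun v _ hv => hfin v (by rintro rfl; simp at hv))
  have h3 := hW.simpleIntegral_map (φ.pair ψ) (fun v => v.1 - v.2)
    (fun v _ hv => hfin v (by rintro rfl; simp at hv))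
  rw [SimpleFunc.map_fst_pair] at h1
  rw [SimpleFunc.map_snd_pair] at h2
  have h4 : (φ.pair ψ).map (fun v => v.1 - v.2) = φ - ψ := by ext x; simp
  rw [h4] at h3
  filter_upwards [h1, h2, h3] with ω h1 h2 h3
  rw [h1, h2, h3, ← Finset.sum_sub_distrib]
  simp_rw [sub_mul]

lemma IsCauchyWhiteNoise.simpleIntegral_const_mul (hW : IsCauchyWhiteNoise P W)
    {φ : SimpleFunc Plane ℝ} (hφ : Integrable φ volume) (c : ℝ) :
    simpleIntegral W (φ.map fun y => c * y) =ᵐ[P] fun ω => c * simpleIntegral W φ ω := by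
  filter_upwards [hW.simpleIntegral_map φ (fun y => c * y) fun y _ hy =>
    SimpleFunc.measure_preimage_lt_top_of_integrable φ hφ (right_ne_zero_of_mul hy)] with ω h
  rw [h, simpleIntegral, Finset.mul_sum]
  simp_rw [mul_assoc]

lemma IsStochasticIntegral.sub_simpleIntegral (hW : IsCauchyWhiteNoise P W) {f : Plane → ℝ}
    {X : Ω → ℝ} (h : IsStochasticIntegral P W f X) {ψ : SimpleFunc Plane ℝ}
    (hψ : Integrable ψ volume) :
    IsStochasticIntegral P W (fun x => f x - ψ x) (fun ω => X ω - simpleIntegral W ψ ω) := by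
  obtain ⟨hX, φ, hφ, hlim, hprob⟩ := h
  refine ⟨hX.sub (hW.measurable_simpleIntegral hψ).aemeasurable, fun n => φ n - ψ,
    fun n => (hφ n).sub hψ, by simpa using hlim, ?_⟩
  refine TendstoInMeasure.congr_left (fun n => (hW.simpleIntegral_sub (hφ n) hψ).symm) ?_
  simpa [TendstoInMeasure] using hprob

lemma IsStochasticIntegral.const_mul (hW : IsCauchyWhiteNoise P W) {f : Plane → ℝ}
    {X : Ω → ℝ} (h : IsStochasticIntegral P W f X) (c : ℝ) :
    IsStochasticIntegral P W (fun x => c * f x) (fun ω => c * X ω) := by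
  obtain ⟨hX, φ, hφ, hlim, hprob⟩ := h
  refine ⟨hX.const_mul c, fun n => (φ n).map fun y => c * y,
    fun n => by simpa [Function.comp_def] using (hφ n).const_mul c, ?_, ?_⟩
  · have h1 : ∀ n, ∫⁻ x, ‖((φ n).map fun y => c * y) x - c * f x‖ₑ
        = ‖c‖ₑ * ∫⁻ x, ‖φ n x - f x‖ₑ := fun n => by
      rw [← lintegral_const_mul' _ _ (by simp)]
      simp [← mul_sub, enorm_mul]
    simp_rw [h1]
    simpa using ENNReal.Tendsto.const_mul hlim (Or.inr (by simp))
  · refine TendstoInMeasure.congr_left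
      (fun n => (hW.simpleIntegral_const_mul (hφ n) c).symm) ?_
    intro ε hε
    rcases eq_or_ne c 0 with rfl | hc
    · simp [hε.ne']
    have h0 : ‖c‖ₑ ≠ 0 := by simpa using hc
    refine (hprob (ε / ‖c‖ₑ) (ENNReal.div_pos hε.ne' (by simp))).congr fun n => ?_
    congr 1
    ext ω
    simp [edist_eq_enorm_sub, ← mul_sub, enorm_mul, ENNReal.div_le_iff' h0]

variable [IsProbabilityMeasure P]

/-- The convolution property of Cauchy laws is read off the noise itself: `W (A ∪ B)` is Cauchy of
scale `a + b` and is also a sum of independent Cauchy variables of scales `a` and `b`. -/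
lemma IsCauchyWhiteNoise.charFun_add (hW : IsCauchyWhiteNoise P W) (a b : ℝ≥0) (t : ℝ) :
    charFun (cauchyMeasure 0 (a + b)) t
      = charFun (cauchyMeasure 0 a) t * charFun (cauchyMeasure 0 b) t := by
  obtain ⟨A, B, hA, hB, hA', hB', hAB⟩ := exists_disjoint_volume_eq a b
  have hAf : volume A < ∞ := by simp [hA']
  have hBf : volume B < ∞ := by simp [hB']
  have hi := (hW.iIndepFun (ι := Fin 2) (A := ![A, B]) (fun i => by fin_cases i <;> simpa)
    (fun i => by fin_cases i <;> simpa) (fun i j hij => by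
      fin_cases i <;> fin_cases j
      · exact absurd rfl hij
      · exact hAB
      · exact hAB.symm
      · exact absurd rfl hij)).indepFun (i := 0) (j := 1) (by simp)
  simp only [Matrix.cons_val_zero, Matrix.cons_val_one] at hi
  have h1 := hi.charFun_map_fun_add_eq_mul (hW.measurable A hA hAf).aemeasurable
    (hW.measurable B hB hBf).aemeasurable
  have h2 := hW.law (A ∪ B) (hA.union hB) (measure_union_lt_top hAf hBf)
  rw [Measure.map_congr (hW.ae_union hA hB hAf hBf hAB)] at h2
  rw [h2, hW.law A hA hAf, hW.law B hB hBf, measure_union hAB hB, hA', hB'] at h1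
  have h3 : ((a : ℝ≥0∞) + b).toNNReal = a + b := by
    rw [← ENNReal.coe_add, ENNReal.toNNReal_coe]
  rw [h3] at h1
  simpa using congrFun h1 t

lemma IsCauchyWhiteNoise.charFun_sum (hW : IsCauchyWhiteNoise P W) {ι : Type*} (s : Finset ι)
    (γ : ι → ℝ≥0) (t : ℝ) :
    charFun (cauchyMeasure 0 (∑ i ∈ s, γ i)) t = ∏ i ∈ s, charFun (cauchyMeasure 0 (γ i)) t := by
  classical
  induction s using Finset.induction_on with
  | empty => simp
  | insert a s ha ih => rw [Finset.sum_insert ha, Finset.prod_insert ha, hW.charFun_add, ih]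

/-- A linear combination of the values at disjoint sets has a Cauchy distribution. -/
lemma IsCauchyWhiteNoise.map_sum (hW : IsCauchyWhiteNoise P W) {ι : Type*} [Fintype ι]
    {A : ι → Set Plane} (hA : ∀ i, MeasurableSet (A i)) (hA' : ∀ i, volume (A i) < ∞)
    (hd : Pairwise (Function.onFun Disjoint A)) (c : ι → ℝ) :
    P.map (fun ω => ∑ i, c i * W (A i) ω)
      = cauchyMeasure 0 (∑ i, ‖c i‖₊ * (volume (A i)).toNNReal) := by
  have hm : ∀ i, AEMeasurable (fun ω => c i * W (A i) ω) P := fun i =>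
    ((hW.measurable (A i) (hA i) (hA' i)).const_mul _).aemeasurable
  have hi : ProbabilityTheory.iIndepFun (fun i ω => c i * W (A i) ω) P :=
    (hW.iIndepFun hA hA' hd).comp (fun i x => c i * x) fun i => measurable_const_mul _
  have : IsProbabilityMeasure (P.map (fun ω => ∑ i, c i * W (A i) ω)) :=
    Measure.isProbabilityMeasure_map (Finset.univ.aemeasurable_fun_sum fun i _ => hm i)
  refine Measure.ext_of_charFun (funext fun t => ?_)
  rw [hi.charFun_map_fun_sum_eq_prod hm, Finset.prod_apply, hW.charFun_sum]
  refine Finset.prod_congr rfl fun i _ => ?_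
  rw [map_const_mul_of_map_eq_cauchyMeasure
    (hW.measurable (A i) (hA i) (hA' i)).aemeasurable (hW.law _ (hA i) (hA' i))]

lemma IsCauchyWhiteNoise.map_simpleIntegral (hW : IsCauchyWhiteNoise P W)
    {φ : SimpleFunc Plane ℝ} (hφ : Integrable φ volume) :
    P.map (simpleIntegral W φ) = cauchyMeasure 0 (∫ x, |φ x|).toNNReal := by
  have hfin : ∀ y : {y // y ∈ φ.range.filter (· ≠ 0)}, volume (φ ⁻¹' {(y : ℝ)}) < ∞ := fun y =>
    SimpleFunc.measure_preimage_lt_top_of_integrable φ hφ (Finset.mem_filter.1 y.2).2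
  rw [simpleIntegral_eq_sum_filter, hW.map_sum (A := fun y : {y // y ∈ φ.range.filter (· ≠ 0)} =>
    φ ⁻¹' {(y : ℝ)}) (fun y => φ.measurableSet_fiber _) hfin
    (fun u v huv => Disjoint.preimage _ (disjoint_singleton.2 fun h => huv (Subtype.ext h)))]
  congr 1
  have h1 : ∫ x, |φ x| = ∑ y ∈ φ.range, volume.real (φ ⁻¹' {y}) * |y| := by
    have h2 := SimpleFunc.map_integral (μ := volume) φ (fun y => |y|) hφ (by simp)
    rw [SimpleFunc.integral_eq_integral _ (by simpa [Function.comp_def] using hφ.abs)] at h2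
    simpa using h2
  have h3 : ∑ y ∈ φ.range, volume.real (φ ⁻¹' {y}) * |y|
      = ∑ y ∈ φ.range.filter (· ≠ 0), volume.real (φ ⁻¹' {y}) * |y| :=
    (Finset.sum_filter_of_ne fun y _ hy => by simpa using right_ne_zero_of_mul hy).symm
  rw [h1, h3, ← Finset.sum_coe_sort (φ.range.filter (· ≠ 0))
    (fun y => volume.real (φ ⁻¹' {y}) * |y|)]
  refine NNReal.eq ?_
  rw [Real.coe_toNNReal _ (Finset.sum_nonneg fun y _ => by positivity), NNReal.coe_sum]
  refine Fintype.sum_congr _ _ fun y => ?_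
  rw [NNReal.coe_mul, mul_comm]
  rfl

/-- Convergence in probability gives convergence of characteristic functions, while L¹ convergence
of the simple integrands gives convergence of their Cauchy scales. -/
lemma IsStochasticIntegral.map_eq (hW : IsCauchyWhiteNoise P W) {f : Plane → ℝ} {X : Ω → ℝ}
    (hf : Integrable f volume) (h : IsStochasticIntegral P W f X) :
    P.map X = cauchyMeasure 0 (∫ x, |f x|).toNNReal := by
  obtain ⟨hX, φ, hφ, hlim, hprob⟩ := h
  have h1 : Tendsto (fun n => ∫ x, |φ n x|) atTop (𝓝 (∫ x, |f x|)) := by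
    refine tendsto_integral_of_L1 _ hf.abs.aestronglyMeasurable
      (Eventually.of_forall fun n => (hφ n).abs) ?_
    refine tendsto_of_tendsto_of_tendsto_of_le_of_le tendsto_const_nhds hlim
      (fun _ => zero_le) fun n => lintegral_mono fun x => ?_
    rw [enorm_le_iff_norm_le]
    simpa using abs_abs_sub_abs_le_abs_sub (φ n x) (f x)
  have h2 := hprob.tendstoInDistribution
    (fun n => (hW.measurable_simpleIntegral (hφ n)).aemeasurable)
  have h3 := ProbabilityMeasure.tendsto_iff_tendsto_charFun.1 h2.tendsto
  have : IsProbabilityMeasure (P.map X) := Measure.isProbabilityMeasure_map hX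
  refine Measure.ext_of_charFun (funext fun t => ?_)
  refine tendsto_nhds_unique (h3 t) ?_
  simp only [ProbabilityMeasure.coe_mk, hW.map_simpleIntegral (hφ _)]
  rw [charFun_cauchyMeasure]
  simp_rw [charFun_cauchyMeasure (Real.toNNReal _)]
  refine (continuous_charFun.tendsto _).comp ?_
  simp_rw [Real.coe_toNNReal _ (integral_nonneg fun x => abs_nonneg _)]
  exact h1.mul_const t

end WhiteNoise

/-- Since the tail is of order `1/t`, changing the threshold by a factor `1 ± δ` divides the limit
by it; this picks `δ` so that the change costs at most `ε`. -/
lemma exists_delta {L ε : ℝ} (hL : 0 ≤ L) (hε : 0 < ε) :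
    ∃ δ, 0 < δ ∧ δ < 1 ∧ L / (1 - δ) ≤ L + ε ∧ L - ε ≤ L / (1 + δ) := by
  have hLε : 0 < L + ε := by linarith
  refine ⟨min (1 / 2) (ε / (L + ε)), by positivity,
    (min_le_left _ _).trans_lt (by norm_num), ?_, ?_⟩
  all_goals
    set δ := min (1 / 2) (ε / (L + ε)) with hδ
    have h0 : 0 < δ := by positivity
    have h1 : δ ≤ 1 / 2 := min_le_left _ _
    have h2 : δ * (L + ε) ≤ ε := by
      rw [← le_div_iff₀ hLε]; exact min_le_right _ _
  · rw [div_le_iff₀ (by linarith)]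
    nlinarith
  · rw [le_div_iff₀ (by linarith)]
    nlinarith

/-! ### One big jump for finitely many independent Cauchy variables. -/

section OneJump

variable {Ω : Type*} [MeasurableSpace Ω] {P : Measure Ω} [IsProbabilityMeasure P]
  {ι κ : Type*} [Fintype ι] [Fintype κ]

/-- Two independent Cauchy variables are rarely large together. -/
lemma real_iUnion_pair_le {Y : ι → Ω → ℝ} (hY : ∀ i, Measurable (Y i)) {γ : ι → ℝ≥0}
    (hlaw : ∀ i, P.map (Y i) = cauchyMeasure 0 (γ i)) (hind : iIndepFun Y P) {t : ℝ}
    (ht : 0 < t) :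
    P.real (⋃ p : {p : ι × ι // p.1 ≠ p.2}, {ω | t < |Y p.1.1 ω|} ∩ {ω | t < |Y p.1.2 ω|})
      ≤ ((∑ i, (γ i : ℝ)) / t) ^ 2 := by
  classical
  have h1 : ∀ p : {p : ι × ι // p.1 ≠ p.2},
      P.real ({ω | t < |Y p.1.1 ω|} ∩ {ω | t < |Y p.1.2 ω|})
        ≤ (γ p.1.1 / t) * (γ p.1.2 / t) := by
    intro p
    have hs : MeasurableSet {y : ℝ | t < |y|} := measurableSet_lt measurable_const (by fun_prop)
    have h := (hind.indepFun p.2).measure_inter_preimage_eq_mul _ _ hs hs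
    have h' : P.real ({ω | t < |Y p.1.1 ω|} ∩ {ω | t < |Y p.1.2 ω|})
        = P.real {ω | t < |Y p.1.1 ω|} * P.real {ω | t < |Y p.1.2 ω|} := by
      simp only [measureReal_def, ← ENNReal.toReal_mul]
      exact congrArg ENNReal.toReal h
    rw [h']
    have hb := fun i => real_lt_abs_le_of_map_eq_cauchyMeasure (hY i).aemeasurable (hlaw i) ht
    gcongr <;> exact hb _
  refine (measureReal_iUnion_fintype_le _).trans ((Finset.sum_le_sum fun p _ => h1 p).trans ?_)
  rw [Finset.sum_div, sq, Finset.sum_mul_sum, ← Finset.sum_product', Finset.univ_product_univ]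
  rw [← Fintype.sum_subtype_add_sum_subtype (fun p : ι × ι => p.1 ≠ p.2)]
  exact le_add_of_nonneg_right (Finset.sum_nonneg fun p _ => by positivity)

/-- The principle of one big jump for nonnegative linear combinations of independent Cauchy
variables. -/
lemma tendsto_mul_real_exists_lt_sum {Y : ι → Ω → ℝ} (hY : ∀ i, Measurable (Y i)) {γ : ι → ℝ≥0}
    (hlaw : ∀ i, P.map (Y i) = cauchyMeasure 0 (γ i)) (hind : iIndepFun Y P)
    {a : ι → κ → ℝ} (ha : ∀ i j, 0 ≤ a i j) :
    Tendsto (fun n : ℕ => (n : ℝ) * P.real {ω | ∃ j, (n : ℝ) < ∑ i, a i j * Y i ω}) atTop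
      (𝓝 ((∑ i, γ i * ⨆ j, a i j) / Real.pi)) := by
  classical
  have hpi := Real.pi_pos
  set c : ι → ℝ := fun i => γ i * ⨆ j, a i j with hc
  have hm : ∀ i, 0 ≤ ⨆ j, a i j := fun i => Real.iSup_nonneg (ha i)
  have hc0 : ∀ i, 0 ≤ c i := fun i => mul_nonneg (γ i).2 (hm i)
  refine tendsto_of_forall_approx fun ε hε => ?_
  obtain ⟨δ, hδ0, hδ1, hu, hl⟩ :=
    exists_delta (L := (∑ i, c i) / Real.pi)
      (div_nonneg (Finset.sum_nonneg fun i _ => hc0 i) hpi.le) hε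
  set S : ℝ := (∑ i, ∑ j, a i j) + 1 with hS
  have hS0 : 0 < S := add_pos_of_nonneg_of_pos
    (Finset.sum_nonneg fun i _ => Finset.sum_nonneg fun j _ => ha i j) one_pos
  have haS : ∀ i j, a i j ≤ S := fun i j => by
    have h1 := Finset.single_le_sum (f := fun j => a i j) (fun j _ => ha i j) (Finset.mem_univ j)
    have h2 := Finset.single_le_sum (f := fun i => ∑ j, a i j)
      (fun i _ => Finset.sum_nonneg fun j _ => ha i j) (Finset.mem_univ i)
    linarith
  have haS' : ∀ j, ∑ i, a i j ≤ S := fun j => by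
    have h1 : ∑ i, a i j ≤ ∑ i, ∑ j, a i j := Finset.sum_le_sum fun i _ =>
      Finset.single_le_sum (f := fun j => a i j) (fun j _ => ha i j) (Finset.mem_univ j)
    linarith
  -- With `S` bounding every coefficient and every column sum, summands with `|Y i| ≤ n * η`
  -- contribute at most `n * δ` together, and a term above `n * δ` forces `|Y i| > n * η`.
  set η : ℝ := δ / S with hη
  have hη0 : 0 < η := div_pos hδ0 hS0
  have hηS : η * S = δ := div_mul_cancel₀ _ hS0.ne'
  -- `E` is the exceedance, `B` the event of two big jumps (probability of order `n⁻²`), and `G θ n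
  -- i` the exceedance of level `n * θ` by the `i`-th jump alone. Off `B`, `E` lies between the
  -- unions of the `G (1 + δ) n i` and of the `G (1 - δ) n i`.
  let E : ℕ → Set Ω := fun n => {ω | ∃ j, (n : ℝ) < ∑ i, a i j * Y i ω}
  let B : ℕ → Set Ω := fun n => ⋃ p : {p : ι × ι // p.1 ≠ p.2},
    {ω | n * η < |Y p.1.1 ω|} ∩ {ω | n * η < |Y p.1.2 ω|}
  let G : ℝ → ℕ → ι → Set Ω := fun θ n i => {ω | n * θ < (⨆ j, a i j) * Y i ω}
  have hG : ∀ θ, 0 < θ → ∀ n : ℕ, 0 < n → ∀ i,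
      P.real (G θ n i) = Real.arctan (c i / θ / n) / Real.pi := by
    intro θ hθ n hn i
    have h1 := map_const_mul_of_map_eq_cauchyMeasure (hY i).aemeasurable (hlaw i) (⨆ j, a i j)
    have h2 := real_lt_of_map_eq_cauchyMeasure ((hY i).const_mul _).aemeasurable h1
      (t := n * θ) (by positivity)
    refine h2.trans ?_
    congr 2
    rw [NNReal.coe_mul, coe_nnnorm, Real.norm_of_nonneg (hm i), div_div, mul_comm (n : ℝ) θ,
      mul_comm (⨆ j, a i j)]
  have hBm : ∀ n, MeasurableSet (B n) := fun n => MeasurableSet.iUnion fun p =>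
    (measurableSet_lt measurable_const (hY _).abs).inter
      (measurableSet_lt measurable_const (hY _).abs)
  have hGm : ∀ θ n i, MeasurableSet (G θ n i) := fun θ n i =>
    measurableSet_lt measurable_const ((hY i).const_mul _)
  have hsmall : ∀ (n : ℕ) ω i, (∀ i', i' ≠ i → |Y i' ω| ≤ n * η) → ∀ j,
      |(∑ i, a i j * Y i ω) - a i j * Y i ω| ≤ n * δ := by
    intro n ω i h j
    rw [← Finset.add_sum_erase _ _ (Finset.mem_univ i), add_sub_cancel_left]
    calc |∑ i' ∈ Finset.univ.erase i, a i' j * Y i' ω|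
        ≤ ∑ i' ∈ Finset.univ.erase i, |a i' j * Y i' ω| := Finset.abs_sum_le_sum_abs _ _
      _ ≤ ∑ i' ∈ Finset.univ.erase i, a i' j * (n * η) := by
        refine Finset.sum_le_sum fun i' hi' => ?_
        rw [abs_mul, abs_of_nonneg (ha i' j)]
        exact mul_le_mul_of_nonneg_left (h i' (Finset.ne_of_mem_erase hi')) (ha i' j)
      _ ≤ ∑ i', a i' j * (n * η) := Finset.sum_le_sum_of_subset_of_nonneg
        (Finset.erase_subset _ _) fun i' _ _ => mul_nonneg (ha i' j) (by positivity)
      _ = (∑ i', a i' j) * (n * η) := by rw [Finset.sum_mul]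
      _ ≤ S * (n * η) := mul_le_mul_of_nonneg_right (haS' j) (by positivity)
      _ = n * δ := by rw [← hηS]; ring
  have hnotB : ∀ n ω, ω ∉ B n → ∀ i i', i' ≠ i → n * η < |Y i ω| → |Y i' ω| ≤ n * η := by
    intro n ω hω i i' hii' hi
    by_contra! hcon
    exact hω (mem_iUnion.2 ⟨⟨(i, i'), hii'.symm⟩, hi, hcon⟩)
  have hsub1 : ∀ n : ℕ, 0 < n → E n ⊆ B n ∪ ⋃ i, G (1 - δ) n i := by
    rintro n hn ω ⟨j, hj⟩
    by_cases hω : ω ∈ B n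
    · exact Or.inl hω
    right
    have hn' : (0 : ℝ) < n := by exact_mod_cast hn
    have hne : Nonempty ι := by
      by_contra hcon
      rw [not_nonempty_iff] at hcon
      simp at hj
      linarith
    obtain ⟨i, hi⟩ : ∃ i, ∀ i', i' ≠ i → |Y i' ω| ≤ n * η := by
      by_cases h : ∃ i, n * η < |Y i ω|
      · obtain ⟨i, hi⟩ := h
        exact ⟨i, fun i' hii' => hnotB n ω hω i i' hii' hi⟩
      · push Not at h
        exact ⟨hne.some, fun i' _ => h i'⟩
    have h1 := (abs_le.1 (hsmall n ω i hi j)).2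
    refine mem_iUnion.2 ⟨i, ?_⟩
    refine (exists_lt_mul_iff_lt_iSup_mul (a i) (mul_nonneg hn'.le (by linarith)) (ha i)).1 ⟨j, ?_⟩
    linarith
  have hlarge : ∀ n : ℕ, 0 < n → ∀ i, ∀ ω ∈ G (1 + δ) n i,
      n * η < |Y i ω| ∧ ∃ j, n * (1 + δ) < a i j * Y i ω := by
    intro n hn i ω hω
    have hn' : (0 : ℝ) < n := by exact_mod_cast hn
    obtain ⟨j, hj⟩ := (exists_lt_mul_iff_lt_iSup_mul (a i)
      (mul_nonneg hn'.le (by linarith)) (ha i)).2 hω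
    refine ⟨?_, j, hj⟩
    have h1 : a i j * Y i ω ≤ S * |Y i ω| :=
      (mul_le_mul_of_nonneg_left (le_abs_self _) (ha i j)).trans
        (mul_le_mul_of_nonneg_right (haS i j) (abs_nonneg _))
    have h2 : S * (n * η) < S * |Y i ω| := by
      have : S * (n * η) = n * δ := by rw [← hηS]; ring
      nlinarith
    exact lt_of_mul_lt_mul_left h2 hS0.le
  have hsub2 : ∀ n : ℕ, 0 < n → ⋃ i, (G (1 + δ) n i \ B n) ⊆ E n := by
    intro n hn ω hω
    obtain ⟨i, hi, hωB⟩ := mem_iUnion.1 hω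
    obtain ⟨h1, j, hj⟩ := hlarge n hn i ω hi
    have h2 := (abs_le.1 (hsmall n ω i (fun i' hii' => hnotB n ω hωB i i' hii' h1) j)).1
    exact ⟨j, by linarith⟩
  -- Removing `B` makes the single-jump events disjoint, so the lower bound can add their
  -- probabilities, losing `P(B)` once per index.
  have hdisj : ∀ n : ℕ, 0 < n →
      Pairwise (Function.onFun Disjoint fun i => G (1 + δ) n i \ B n) := by
    intro n hn i i' hii'
    refine disjoint_left.2 fun ω h h' => ?_
    have h1 := (hlarge n hn i ω h.1).1
    have h2 := (hlarge n hn i' ω h'.1).1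
    exact absurd (hnotB n ω h.2 i i' hii'.symm h1) (not_le.2 h2)
  have hBlim : Tendsto (fun n : ℕ => (n : ℝ) * ((∑ i, (γ i : ℝ)) / (n * η)) ^ 2) atTop (𝓝 0) := by
    have h1 : Tendsto (fun n : ℕ => ((∑ i, (γ i : ℝ)) / η) ^ 2 * ((n : ℝ))⁻¹) atTop (𝓝 0) := by
      simpa using tendsto_inv_atTop_nhds_zero_nat.const_mul (((∑ i, (γ i : ℝ)) / η) ^ 2)
    refine h1.congr' ?_
    filter_upwards [eventually_gt_atTop 0] with n hn
    have hn' : (n : ℝ) ≠ 0 := by positivity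
    field_simp
  have hGlim : ∀ θ, 0 < θ → Tendsto (fun n : ℕ => ∑ i, (n : ℝ) *
      (Real.arctan (c i / θ / n) / Real.pi)) atTop (𝓝 ((∑ i, c i) / Real.pi / θ)) := by
    intro θ hθ
    have h1 := tendsto_finsetSum Finset.univ fun i _ => tendsto_mul_arctan_div (c i / θ)
    convert! h1 using 2
    rw [Finset.sum_div, Finset.sum_div]
    exact Finset.sum_congr rfl fun i _ => by field_simp
  refine ⟨fun n => ∑ i, (n : ℝ) * (Real.arctan (c i / (1 + δ) / n) / Real.pi)
      - Fintype.card ι * ((n : ℝ) * ((∑ i, (γ i : ℝ)) / (n * η)) ^ 2),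
    fun n => (n : ℝ) * ((∑ i, (γ i : ℝ)) / (n * η)) ^ 2
      + ∑ i, (n : ℝ) * (Real.arctan (c i / (1 - δ) / n) / Real.pi), _, _,
    (hGlim (1 + δ) (by linarith)).sub (hBlim.const_mul _),
    hBlim.add (hGlim (1 - δ) (by linarith)), by simpa using hl, by simpa using hu, ?_⟩
  filter_upwards [eventually_gt_atTop 0] with n hn
  have hn' : (0 : ℝ) < n := by exact_mod_cast hn
  have hPB : P.real (B n) ≤ _ := real_iUnion_pair_le hY hlaw hind (mul_pos hn' hη0)
  constructor
  · have h1 : ∑ i, (Real.arctan (c i / (1 + δ) / n) / Real.pi - P.real (B n)) ≤ P.real (E n) := by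
      refine le_trans (Finset.sum_le_sum fun i _ => ?_)
        ((measureReal_iUnion_fintype (hdisj n hn) fun i => (hGm _ _ i).diff (hBm n)).symm.le.trans
          (measureReal_mono (hsub2 n hn)))
      rw [← hG (1 + δ) (by linarith) n hn i]
      exact le_measureReal_sdiff
    rw [Finset.sum_sub_distrib, Finset.sum_const, Finset.card_univ, nsmul_eq_mul] at h1
    have h2 := mul_le_mul_of_nonneg_left h1 hn'.le
    have h3 := mul_le_mul_of_nonneg_left hPB
      (mul_nonneg hn'.le (Nat.cast_nonneg (α := ℝ) (Fintype.card ι)))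
    rw [mul_sub, Finset.mul_sum] at h2
    change _ ≤ (n : ℝ) * P.real (E n)
    linarith
  · have h1 : P.real (E n) ≤ ((∑ i, (γ i : ℝ)) / (n * η)) ^ 2
        + ∑ i, Real.arctan (c i / (1 - δ) / n) / Real.pi := by
      refine (measureReal_mono (hsub1 n hn)).trans ((measureReal_union_le _ _).trans ?_)
      refine add_le_add hPB ((measureReal_iUnion_fintype_le _).trans ?_)
      exact Finset.sum_le_sum fun i _ => (hG (1 - δ) (by linarith) n hn i).le
    have h2 := mul_le_mul_of_nonneg_left h1 hn'.le
    rw [mul_add, Finset.mul_sum] at h2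
    exact h2

end OneJump

/-- The positive part of a simple function approximating `f` is no farther from `f ≥ 0`;
nonnegativity is what the one-jump argument requires. -/
lemma IsStochasticIntegral.exists_simpleFunc {Ω : Type*} [MeasurableSpace Ω]
    {P : Measure Ω} {W : Set Plane → Ω → ℝ} {f : Plane → ℝ} {X : Ω → ℝ}
    (h : IsStochasticIntegral P W f X) (hf : Integrable f volume) (hf0 : ∀ x, 0 ≤ f x) {ρ : ℝ}
    (hρ : 0 < ρ) : ∃ ψ : SimpleFunc Plane ℝ, Integrable ψ volume ∧ (∀ x, 0 ≤ ψ x) ∧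
      ∫ x, |f x - ψ x| ≤ ρ := by
  obtain ⟨-, φ, hφ, hlim, -⟩ := h
  obtain ⟨n, hn⟩ := (hlim.eventually (gt_mem_nhds (ENNReal.ofReal_pos.2 hρ))).exists
  have hint : Integrable ((φ n).map fun y => max y 0) volume := by
    simpa [Function.comp_def] using (hφ n).pos_part
  refine ⟨(φ n).map fun y => max y 0, hint, fun x => by simp, ?_⟩
  have h1 : ∫ x, |f x - ((φ n).map fun y => max y 0) x| ≤ ∫ x, ‖φ n x - f x‖ := by
    refine integral_mono (hf.sub hint).abs ((hφ n).sub hf).norm fun x => ?_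
    simp only [SimpleFunc.coe_map, Function.comp_apply, Real.norm_eq_abs]
    have := abs_max_sub_max_le_abs (φ n x) (f x) 0
    rwa [max_eq_left (hf0 x), abs_sub_comm] at this
  refine h1.trans ?_
  rw [integral_norm_eq_lintegral_enorm (f := fun x => φ n x - f x)
    ((hφ n).sub hf).aestronglyMeasurable]
  exact (ENNReal.toReal_mono ENNReal.ofReal_ne_top hn.le).trans_eq (ENNReal.toReal_ofReal hρ.le)

/-! ### Joint tails of stochastic integrals. -/

section Tail

variable {Ω : Type*} [MeasurableSpace Ω] {P : Measure Ω} [IsProbabilityMeasure P]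
  {W : Set Plane → Ω → ℝ} {κ : Type*} [Fintype κ]

/-- The simple function with the given components. -/
def simpleFuncPi (φ : κ → SimpleFunc Plane ℝ) : SimpleFunc Plane (κ → ℝ) where
  toFun x j := φ j x
  measurableSet_fiber' v :=
    (measurable_pi_iff.2 fun j => (φ j).measurable) (measurableSet_singleton v)
  finite_range' := (Set.Finite.pi' fun j => (φ j).finite_range).subset <| by
    rintro _ ⟨x, rfl⟩ j
    exact mem_range_self x

/-- The fibres of the vector-valued simple function are disjoint cells on which all the `φ j` are
constant, so the integrals are combinations of the same independent variables. The zero fibre is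
dropped because its area may be infinite. -/
lemma IsCauchyWhiteNoise.tendsto_mul_real_exists_lt_simpleIntegral
    (hW : IsCauchyWhiteNoise P W) {φ : κ → SimpleFunc Plane ℝ}
    (hφ : ∀ j, Integrable (φ j) volume) (hφ0 : ∀ j x, 0 ≤ φ j x) {θ : ℝ} (hθ : 0 < θ) :
    Tendsto (fun n : ℕ => (n : ℝ) * P.real {ω | ∃ j, n * θ < simpleIntegral W (φ j) ω}) atTop
      (𝓝 ((∫ x, ⨆ j, φ j x) / Real.pi / θ)) := by
  classical
  set Φ := simpleFuncPi φ with hΦ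
  have hΦx : ∀ x j, Φ x j = φ j x := fun _ _ => rfl
  have hΦi : Integrable Φ volume := integrable_pi_iff.2 hφ
  have hfin : ∀ v, v ≠ 0 → volume (Φ ⁻¹' {v}) < ∞ := fun v hv =>
    SimpleFunc.measure_preimage_lt_top_of_integrable Φ hΦi hv
  let R := Φ.range.filter (· ≠ 0)
  have hR0 : ∀ v : R, ∀ j, 0 ≤ (v : κ → ℝ) j := fun v j => by
    obtain ⟨x, hx⟩ := SimpleFunc.mem_range.1 (Finset.mem_filter.1 v.2).1
    rw [← hx]
    exact hφ0 j x
  have hRfin : ∀ v : R, volume (Φ ⁻¹' {(v : κ → ℝ)}) < ∞ := fun v =>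
    hfin _ (Finset.mem_filter.1 v.2).2
  have hmain := tendsto_mul_real_exists_lt_sum (P := P)
    (Y := fun v : R => W (Φ ⁻¹' {(v : κ → ℝ)})) (a := fun v j => (v : κ → ℝ) j / θ)
    (fun v => hW.measurable _ (Φ.measurableSet_fiber _) (hRfin v))
    (fun v => hW.law _ (Φ.measurableSet_fiber _) (hRfin v))
    (hW.iIndepFun (fun v => Φ.measurableSet_fiber _) hRfin
      (fun u v huv => Disjoint.preimage _
        (disjoint_singleton.2 fun h => huv (Subtype.ext h))))
    (fun v j => div_nonneg (hR0 v j) hθ.le)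
  have hint : (∫ x, ⨆ j, φ j x) / Real.pi / θ = (∑ v : R,
      ((volume (Φ ⁻¹' {(v : κ → ℝ)})).toNNReal : ℝ) * ⨆ j, (v : κ → ℝ) j / θ) / Real.pi := by
    have h0 : (⨆ _ : κ, (0 : ℝ)) = 0 := by
      rcases isEmpty_or_nonempty κ with hκ | hκ <;> simp
    have h1 : ∫ x, ⨆ j, φ j x = ∑ v ∈ Φ.range, volume.real (Φ ⁻¹' {v}) * ⨆ j, v j := by
      have h2 := SimpleFunc.map_integral (μ := volume) Φ (fun v => ⨆ j, v j) hΦi (by simp)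
      rw [SimpleFunc.integral_eq_integral _ (by
        simpa [Function.comp_def, hΦx] using integrable_iSup hφ)] at h2
      simpa [hΦx] using h2
    have h3 : ∑ v ∈ Φ.range, volume.real (Φ ⁻¹' {v}) * ⨆ j, v j
        = ∑ v ∈ R, volume.real (Φ ⁻¹' {v}) * ⨆ j, v j := by
      refine (Finset.sum_filter_of_ne fun v _ hv => ?_).symm
      rintro rfl
      exact hv (by simp [h0])
    rw [h1, h3, ← Finset.sum_coe_sort R (fun v => volume.real (Φ ⁻¹' {v}) * ⨆ j, v j),
      div_right_comm, Finset.sum_div]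
    congr 1
    refine Fintype.sum_congr _ _ fun v => ?_
    simp_rw [div_eq_mul_inv]
    rw [← Real.iSup_mul_of_nonneg (inv_nonneg.2 hθ.le), mul_assoc]
    rfl
  rw [hint]
  refine hmain.congr fun n => ?_
  congr 1
  refine measureReal_congr ?_
  have hae : ∀ᵐ ω ∂P, ∀ j, simpleIntegral W (φ j) ω
      = ∑ v : R, (v : κ → ℝ) j * W (Φ ⁻¹' {(v : κ → ℝ)}) ω := by
    refine ae_all_iff.2 fun j => ?_
    have h1 := hW.simpleIntegral_map Φ (fun v => v j)
      (fun v _ hv => hfin v (by rintro rfl; exact hv rfl))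
    have h2 : Φ.map (fun v => v j) = φ j := by ext x; rfl
    rw [h2] at h1
    filter_upwards [h1] with ω h1
    rw [h1, Finset.sum_coe_sort R (fun v => v j * W (Φ ⁻¹' {v}) ω)]
    refine (Finset.sum_filter_of_ne fun v _ hv => ?_).symm
    rintro rfl
    exact hv (by simp)
  filter_upwards [hae] with ω hω
  refine propext (exists_congr fun j => ?_)
  rw [hω j, ← lt_div_iff₀ hθ, Finset.sum_div]
  simp_rw [div_mul_eq_mul_div]

/-- The joint upper tail of stochastic integrals with respect to a Cauchy white noise. -/
lemma IsCauchyWhiteNoise.tendsto_mul_real_exists_lt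
    (hW : IsCauchyWhiteNoise P W) {f : κ → Plane → ℝ} {X : κ → Ω → ℝ}
    (hf : ∀ j, Integrable (f j) volume) (hf0 : ∀ j x, 0 ≤ f j x)
    (hX : ∀ j, IsStochasticIntegral P W (f j) (X j)) :
    Tendsto (fun n : ℕ => (n : ℝ) * P.real {ω | ∃ j, n < X j ω}) atTop
      (𝓝 ((∫ x, ⨆ j, f j x) / Real.pi)) := by
  have hpi := Real.pi_gt_three
  refine tendsto_of_forall_approx fun ε hε => ?_
  set L := (∫ x, ⨆ j, f j x) / Real.pi with hL
  have hL0 : 0 ≤ L := div_nonneg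
    (integral_nonneg fun x => Real.iSup_nonneg fun j => hf0 j x) (by linarith)
  obtain ⟨δ, hδ0, hδ1, hu, hl⟩ := exists_delta hL0 (half_pos hε)
  -- Chosen so that `ρ / (1 - δ) + ρ / δ = ε / 2`: the first term is the change of the limit, the
  -- second the probability that an approximation error exceeds `n * δ`.
  set ρ := ε / 2 * δ * (1 - δ) with hρ
  have hρ0 : 0 < ρ := mul_pos (by positivity) (by linarith)
  set N : ℝ := Fintype.card κ + 1 with hN
  have hN0 : 0 < N := by positivity
  choose ψ hψ hψ0 hψρ using fun j => (hX j).exists_simpleFunc (hf j) (hf0 j) (div_pos hρ0 hN0)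
  have hsum : ∑ j, ∫ x, |f j x - ψ j x| ≤ ρ := by
    refine (Finset.sum_le_sum fun j _ => hψρ j).trans ?_
    rw [Finset.sum_const, Finset.card_univ, nsmul_eq_mul, mul_div_assoc', div_le_iff₀ hN0, mul_comm]
    exact mul_le_mul_of_nonneg_left (by simp [hN]) hρ0.le
  set M := (∫ x, ⨆ j, ψ j x) / Real.pi with hM
  have hML : |L - M| ≤ ρ := by
    rw [hL, hM, ← sub_div, abs_div, abs_of_pos Real.pi_pos, div_le_iff₀ Real.pi_pos]
    refine ((abs_integral_iSup_sub_le hf hψ).trans hsum).trans ?_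
    nlinarith
  have hML' := abs_le.1 hML
  have hdiff : ∀ n : ℕ, 0 < n →
      (n : ℝ) * P.real (⋃ j, {ω | n * δ < |X j ω - simpleIntegral W (ψ j) ω|}) ≤ ρ / δ := by
    intro n hn
    have hn' : (0 : ℝ) < n := by exact_mod_cast hn
    have h1 : P.real (⋃ j, {ω | n * δ < |X j ω - simpleIntegral W (ψ j) ω|}) ≤ ρ / (n * δ) := by
      refine (measureReal_iUnion_fintype_le _).trans ?_
      refine le_trans (Finset.sum_le_sum fun j _ => ?_)
        (((Finset.sum_div _ _ _).symm.le).trans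
          (div_le_div_of_nonneg_right hsum (mul_pos hn' hδ0).le))
      have hs := (hX j).sub_simpleIntegral hW (hψ j)
      have := real_lt_abs_le_of_map_eq_cauchyMeasure hs.1
        (hs.map_eq hW ((hf j).sub (hψ j))) (mul_pos hn' hδ0)
      rwa [Real.coe_toNNReal _ (integral_nonneg fun x => abs_nonneg _)] at this
    refine (mul_le_mul_of_nonneg_left h1 hn'.le).trans_eq ?_
    field_simp
  have hρδ : ρ / (1 - δ) + ρ / δ = ε / 2 := by
    have : 1 - δ ≠ 0 := by linarith
    rw [hρ]; field_simp; ring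
  refine ⟨_, _, _, _,
    (hW.tendsto_mul_real_exists_lt_simpleIntegral hψ hψ0 (θ := 1 + δ) (by linarith)).sub_const
      (ρ / δ),
    (hW.tendsto_mul_real_exists_lt_simpleIntegral hψ hψ0 (θ := 1 - δ) (by linarith)).add_const
      (ρ / δ), ?_, ?_, ?_⟩
  · have h1 : (L - ρ) / (1 + δ) ≤ M / (1 + δ) :=
      div_le_div_of_nonneg_right (by linarith) (by linarith)
    have h2 : ρ / (1 + δ) ≤ ρ / (1 - δ) :=
      div_le_div_of_nonneg_left hρ0.le (by linarith) (by linarith)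
    rw [sub_div] at h1
    linarith
  · have h1 : M / (1 - δ) ≤ (L + ρ) / (1 - δ) :=
      div_le_div_of_nonneg_right (by linarith) (by linarith)
    rw [add_div] at h1
    linarith
  · filter_upwards [eventually_gt_atTop 0] with n hn
    have hn' : (0 : ℝ) < n := by exact_mod_cast hn
    constructor
    · have h1 : {ω | ∃ j, n * (1 + δ) < simpleIntegral W (ψ j) ω} ⊆ {ω | ∃ j, n < X j ω} ∪
          ⋃ j, {ω | n * δ < |X j ω - simpleIntegral W (ψ j) ω|} := by
        rintro ω ⟨j, hj⟩
        by_cases h : n * δ < |X j ω - simpleIntegral W (ψ j) ω|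
        · exact Or.inr (mem_iUnion.2 ⟨j, h⟩)
        · have := (abs_le.1 (not_lt.1 h)).1
          exact Or.inl ⟨j, by linarith⟩
      have h2 := mul_le_mul_of_nonneg_left
        ((measureReal_mono (μ := P) h1).trans (measureReal_union_le _ _)) hn'.le
      have h3 := hdiff n hn
      linarith
    · have h1 : {ω | ∃ j, n < X j ω} ⊆ {ω | ∃ j, n * (1 - δ) < simpleIntegral W (ψ j) ω} ∪
          ⋃ j, {ω | n * δ < |X j ω - simpleIntegral W (ψ j) ω|} := by
        rintro ω ⟨j, hj⟩
        by_cases h : n * δ < |X j ω - simpleIntegral W (ψ j) ω|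
        · exact Or.inr (mem_iUnion.2 ⟨j, h⟩)
        · have := (abs_le.1 (not_lt.1 h)).2
          exact Or.inl ⟨j, by linarith⟩
      have h2 := mul_le_mul_of_nonneg_left
        ((measureReal_mono (μ := P) h1).trans (measureReal_union_le _ _)) hn'.le
      have h3 := hdiff n hn
      linarith

/-- The joint upper tail, locally uniformly in the (inverse) thresholds. -/
lemma IsCauchyWhiteNoise.tendsto_mul_real_exists_lt_mul
    (hW : IsCauchyWhiteNoise P W) {f : κ → Plane → ℝ} {X : κ → Ω → ℝ}
    (hf : ∀ j, Integrable (f j) volume) (hf0 : ∀ j x, 0 ≤ f j x)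
    (hX : ∀ j, IsStochasticIntegral P W (f j) (X j)) {b : ℕ → κ → ℝ} {c : κ → ℝ}
    (hb : ∀ᶠ n in atTop, ∀ j, 0 ≤ b n j)
    (hbc : ∀ j, Tendsto (fun n => b n j) atTop (𝓝 (c j))) :
    Tendsto (fun n : ℕ => (n : ℝ) * P.real {ω | ∃ j, n < b n j * X j ω}) atTop
      (𝓝 ((∫ x, ⨆ j, c j * f j x) / Real.pi)) := by
  have hpi := Real.pi_gt_three
  have hc : ∀ j, 0 ≤ c j := fun j =>
    ge_of_tendsto (hbc j) (hb.mono fun n h => h j)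
  have hlim : ∀ a : κ → ℝ, (∀ j, 0 ≤ a j) → Tendsto (fun n : ℕ =>
      (n : ℝ) * P.real {ω | ∃ j, n < a j * X j ω}) atTop
      (𝓝 ((∫ x, ⨆ j, a j * f j x) / Real.pi)) := fun a ha =>
    hW.tendsto_mul_real_exists_lt (fun j => (hf j).const_mul _)
      (fun j x => mul_nonneg (ha j) (hf0 j x)) (fun j => (hX j).const_mul hW _)
  -- Exceeding a nonnegative level forces `X j > 0`, so the tail is monotone in the coefficients;
  -- hence `b n` can be trapped between constant vectors near `c`.
  have hmono : ∀ a a' : κ → ℝ, (∀ j, 0 ≤ a j) → (∀ j, a j ≤ a' j) → ∀ n : ℕ,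
      (n : ℝ) * P.real {ω | ∃ j, n < a j * X j ω} ≤ n * P.real {ω | ∃ j, n < a' j * X j ω} := by
    intro a a' ha haa' n
    refine mul_le_mul_of_nonneg_left (measureReal_mono ?_) n.cast_nonneg
    rintro ω ⟨j, hj⟩
    have h1 : 0 < X j ω :=
      pos_of_mul_pos_right (n.cast_nonneg.trans_lt hj) (ha j)
    exact ⟨j, hj.trans_le (mul_le_mul_of_nonneg_right (haa' j) h1.le)⟩
  refine tendsto_of_forall_approx fun ε hε => ?_
  set S := (∑ j, ∫ x, f j x) + 1 with hS
  have hS0 : 0 < S :=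
    add_pos_of_nonneg_of_pos (Finset.sum_nonneg fun j _ => integral_nonneg (hf0 j)) one_pos
  set η := ε / S with hη
  have hη0 : 0 < η := by positivity
  have hdist : ∀ a : κ → ℝ, (∀ j, |a j - c j| ≤ η) →
      |(∫ x, ⨆ j, a j * f j x) / Real.pi - (∫ x, ⨆ j, c j * f j x) / Real.pi| ≤ ε := by
    intro a ha
    rw [← sub_div, abs_div, abs_of_pos Real.pi_pos, div_le_iff₀ Real.pi_pos]
    have h1 : ∑ j, ∫ x, |a j * f j x - c j * f j x| ≤ ε := by
      calc ∑ j, ∫ x, |a j * f j x - c j * f j x| ≤ ∑ j, η * ∫ x, f j x := by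
            refine Finset.sum_le_sum fun j _ => ?_
            simp_rw [← sub_mul, abs_mul, abs_of_nonneg (hf0 j _)]
            rw [integral_const_mul]
            exact mul_le_mul_of_nonneg_right (ha j) (integral_nonneg (hf0 j))
        _ = η * ∑ j, ∫ x, f j x := by rw [Finset.mul_sum]
        _ ≤ η * S := mul_le_mul_of_nonneg_left (by linarith) hη0.le
        _ = ε := div_mul_cancel₀ _ hS0.ne'
    refine ((abs_integral_iSup_sub_le (fun j => (hf j).const_mul _)
      (fun j => (hf j).const_mul _)).trans h1).trans ?_
    nlinarith
  have hlow := hdist (fun j => max (c j - η) 0) fun j => by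
    have := abs_max_sub_max_le_abs (c j - η) (c j) 0
    rw [max_eq_left (hc j)] at this
    simpa [abs_of_pos hη0] using this
  have hupp := hdist (fun j => c j + η) fun j => by simp [abs_of_pos hη0]
  refine ⟨_, _, _, _, hlim (fun j => max (c j - η) 0) (fun j => le_max_right _ _),
    hlim (fun j => c j + η) (fun j => add_nonneg (hc j) hη0.le),
    by linarith [(abs_le.1 hlow).1], by linarith [(abs_le.1 hupp).2], ?_⟩
  have hev : ∀ᶠ n in atTop, ∀ j, c j - η < b n j ∧ b n j < c j + η :=
    eventually_all.2 fun j =>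
      ((hbc j).eventually (lt_mem_nhds (by linarith))).and
        ((hbc j).eventually (gt_mem_nhds (by linarith)))
  filter_upwards [hb, hev] with n hn hn'
  exact ⟨hmono _ _ (fun j => le_max_right _ _) (fun j => max_le (hn' j).1.le (hn j)) n,
    hmono _ _ hn (fun j => (hn' j).2.le) n⟩

end Tail

/-! ### From tails to copulas and normalized maxima. -/

section Copula

/-- Inversion of the distribution function, with `tan` multiplied out instead of a quantile `γ / tan
(π p)`; this form stays correct at `p = 0`, where both sides are false. -/
lemma one_sub_lt_cdf_cauchyMeasure_iff {γ : ℝ≥0} (hγ : γ ≠ 0) {p : ℝ} (hp0 : 0 ≤ p)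
    (hp : p < 1 / 2) (x : ℝ) :
    1 - p < cdf (cauchyMeasure 0 γ) x ↔ γ < Real.tan (Real.pi * p) * x := by
  have hpi := Real.pi_pos
  have hγ' : (0 : ℝ) < γ := by positivity
  have h1 : 1 - p < cdf (cauchyMeasure 0 γ) x ↔
      Real.pi / 2 - Real.pi * p < Real.arctan (x / γ) := by
    rw [cdf_eq_real, cauchyMeasure_real_Iic hγ, ← sub_lt_iff_lt_add', lt_div_iff₀ hpi]
    constructor <;> intro h <;> nlinarith
  rw [h1]
  rcases hp0.eq_or_lt with rfl | hp0
  · simp [(Real.arctan_lt_pi_div_two _).le]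
  have h2 : Real.arctan (Real.tan (Real.pi / 2 - Real.pi * p)) = Real.pi / 2 - Real.pi * p :=
    Real.arctan_tan (by nlinarith) (by nlinarith)
  have h3 : 0 < Real.tan (Real.pi * p) :=
    Real.tan_pos_of_pos_of_lt_pi_div_two (by positivity) (by nlinarith)
  rw [← h2, Real.arctan_strictMono.lt_iff_lt, Real.tan_pi_div_two_sub, lt_div_iff₀ hγ',
    inv_mul_lt_iff₀ h3]

lemma cdf_cauchyMeasure_pos {γ : ℝ≥0} (hγ : γ ≠ 0) (x : ℝ) :
    0 < cdf (cauchyMeasure 0 γ) x := by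
  have h := (div_lt_div_iff_of_pos_right Real.pi_pos).2 (Real.neg_pi_div_two_lt_arctan (x / γ))
  rw [cdf_eq_real, cauchyMeasure_real_Iic hγ]
  have h1 : -(Real.pi / 2) / Real.pi = -(1 / 2) := by field_simp [Real.pi_pos.ne']
  linarith

lemma tendsto_mul_tan_div {a : ℕ → ℝ} {c : ℝ} (ha : Tendsto a atTop (𝓝 c)) :
    Tendsto (fun n : ℕ => n * Real.tan (a n / n)) atTop (𝓝 c) := by
  have hd : HasDerivAt Real.tan 1 0 := by
    simpa using Real.hasDerivAt_tan (x := 0) (by simp)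
  have h1 : Tendsto (fun n : ℕ => a n / n) atTop (𝓝 0) :=
    ha.div_atTop tendsto_natCast_atTop_atTop
  -- The continuous extension of the difference quotient allows `a n = 0`.
  have h2 : Tendsto (dslope Real.tan 0) (𝓝 0) (𝓝 1) := by
    have := (continuousAt_dslope_same.2 hd.differentiableAt).tendsto
    rwa [dslope_same, hd.deriv] at this
  have h3 := ha.mul (h2.comp h1)
  rw [mul_one] at h3
  refine h3.congr' ?_
  filter_upwards [eventually_gt_atTop 0] with n hn
  have hn' : (n : ℝ) ≠ 0 := by positivity
  have h4 := sub_smul_dslope Real.tan 0 (a n / n)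
  simp only [sub_zero, smul_eq_mul, Real.tan_zero] at h4
  rw [← h4, Function.comp_apply]
  field_simp

lemma tendsto_mul_one_sub_rpow {u : ℝ} (hu : 0 < u) :
    Tendsto (fun n : ℕ => (n : ℝ) * (1 - u ^ (1 / (n : ℝ)))) atTop (𝓝 (-Real.log u)) := by
  have h1 : Tendsto (fun n : ℕ => ((n : ℝ))⁻¹) atTop (𝓝[>] 0) :=
    tendsto_nhdsWithin_iff.2 ⟨tendsto_inv_atTop_nhds_zero_nat,
      (eventually_gt_atTop 0).mono fun n hn => by simpa using hn⟩
  refine ((tendsto_rpow_sub_one_log hu).comp h1).neg.congr fun n => ?_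
  simp
  ring

lemma real_forall_le_eq {Ω : Type*} [MeasurableSpace Ω] {P : Measure Ω} [IsProbabilityMeasure P]
    {κ : Type*} [Finite κ] {X : κ → Ω → ℝ} (hX : ∀ j, AEMeasurable (X j) P) (t : κ → ℝ) :
    P.real {ω | ∀ j, X j ω ≤ t j} = 1 - P.real {ω | ∃ j, t j < X j ω} := by
  have h1 : NullMeasurableSet {ω | ∃ j, t j < X j ω} P := by
    rw [ofPred_exists]
    exact .iUnion fun j => nullMeasurableSet_lt aemeasurable_const (hX j)
  rw [← probReal_compl_eq_one_sub₀ h1]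
  congr 1
  ext ω
  simp

lemma integral_iSup_eq_maxIntegral (k : Plane → Plane → ℝ) {d : ℕ} (s : Fin d → Plane)
    (w : Fin d → ℝ) :
    (∫ x, ⨆ j, Real.pi * w j / (∫ y, k (s j) y) * k (s j) x) / Real.pi = maxIntegral k s w := by
  rw [div_eq_mul_inv, ← integral_mul_const, maxIntegral]
  congr 1
  ext x
  rw [Real.iSup_mul_of_nonneg (inv_nonneg.2 Real.pi_pos.le)]
  congr 1
  ext j
  have := Real.pi_pos.ne'
  rw [normalizedKernel]
  field_simp

variable {Ω : Type*} [MeasurableSpace Ω] {P : Measure Ω} [IsProbabilityMeasure P]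
  {W : Set Plane → Ω → ℝ} {k : Plane → Plane → ℝ} {Z : Plane → Ω → ℝ} {d : ℕ} {s : Fin d → Plane}

lemma IsConvolutionProcess.map_eq (hZ : IsConvolutionProcess P W k Z)
    (hW : IsCauchyWhiteNoise P W) (hk_nonneg : ∀ s x, 0 ≤ k s x)
    (hk_int : ∀ s, Integrable (k s) volume) (t : Plane) :
    P.map (Z t) = cauchyMeasure 0 (∫ x, k t x).toNNReal := by
  rw [(hZ t).map_eq hW (hk_int t)]
  simp_rw [abs_of_nonneg (hk_nonneg t _)]

/-- Letting `v` vary with `n` makes one limit serve both requirements on a stable tail dependence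
function. -/
lemma IsConvolutionProcess.tendsto_mul_one_sub_copula (hZ : IsConvolutionProcess P W k Z)
    (hW : IsCauchyWhiteNoise P W) (hk_nonneg : ∀ s x, 0 ≤ k s x)
    (hk_int : ∀ s, Integrable (k s) volume) (hs : ∀ j, 0 < ∫ x, k (s j) x)
    {v : ℕ → Fin d → ℝ} {w : Fin d → ℝ} (hv : ∀ n j, 0 ≤ v n j)
    (hvw : ∀ j, Tendsto (fun n => v n j) atTop (𝓝 (w j))) :
    Tendsto (fun n : ℕ => (n : ℝ) * (1 - copula P (fun j => Z (s j)) fun j => 1 - v n j / n))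
      atTop (𝓝 (maxIntegral k s w)) := by
  have hK : ∀ j, (∫ x, k (s j) x).toNNReal ≠ 0 := fun j => by simpa using hs j
  have hev : ∀ᶠ n : ℕ in atTop, ∀ j, v n j / n < 1 / 2 := eventually_all.2 fun j =>
    ((hvw j).div_atTop tendsto_natCast_atTop_atTop).eventually (gt_mem_nhds (by norm_num))
  have hb : ∀ j, Tendsto (fun n : ℕ => n * Real.tan (Real.pi * v n j / n) / ∫ x, k (s j) x) atTop
      (𝓝 (Real.pi * w j / ∫ x, k (s j) x)) := fun j =>
    (tendsto_mul_tan_div ((hvw j).const_mul _)).div_const _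
  have hb0 : ∀ᶠ n : ℕ in atTop, ∀ j, 0 ≤ n * Real.tan (Real.pi * v n j / n) / ∫ x, k (s j) x := by
    filter_upwards [hev] with n hn j
    refine div_nonneg (mul_nonneg n.cast_nonneg (Real.tan_nonneg_of_nonneg_of_le_pi_div_two ?_ ?_))
      (hs j).le
    · exact div_nonneg (mul_nonneg Real.pi_pos.le (hv n j)) n.cast_nonneg
    · rw [mul_div_assoc]
      nlinarith [hn j, Real.pi_pos]
  have h := hW.tendsto_mul_real_exists_lt_mul (fun j => hk_int (s j)) (fun j => hk_nonneg (s j))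
    (fun j => hZ (s j)) hb0 hb
  rw [integral_iSup_eq_maxIntegral] at h
  refine h.congr' ?_
  filter_upwards [hev, eventually_gt_atTop 0] with n hn hn0
  have hn' : (0 : ℝ) < n := by exact_mod_cast hn0
  congr 1
  rw [copula, real_forall_le_eq (X := fun j ω => cdf (P.map (Z (s j))) (Z (s j) ω)) (fun j =>
    (monotone_cdf _).measurable.comp_aemeasurable (hZ (s j)).1), sub_sub_cancel]
  congr 1
  ext ω
  refine exists_congr fun j => ?_
  rw [hZ.map_eq hW hk_nonneg hk_int, one_sub_lt_cdf_cauchyMeasure_iff (hK j)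
    (div_nonneg (hv n j) n.cast_nonneg) (hn j), Real.coe_toNNReal _ (hs j).le,
    div_mul_eq_mul_div, lt_div_iff₀ (hs j), mul_assoc, mul_lt_mul_iff_right₀ hn', mul_div_assoc]

lemma IsConvolutionProcess.isStableTailDependenceFunction (hZ : IsConvolutionProcess P W k Z)
    (hW : IsCauchyWhiteNoise P W) (hk_nonneg : ∀ s x, 0 ≤ k s x)
    (hk_int : ∀ s, Integrable (k s) volume) (hs : ∀ j, 0 < ∫ x, k (s j) x) :
    IsStableTailDependenceFunction (copula P fun j => Z (s j)) (maxIntegral k s) := by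
  refine ⟨fun u hu => ?_, fun w hw => hZ.tendsto_mul_one_sub_copula hW hk_nonneg hk_int hs
    (fun _ => hw) fun j => tendsto_const_nhds⟩
  by_cases hpos : ∀ j, 0 < u j
  · rw [evCopula, if_pos hpos]
    have h := hZ.tendsto_mul_one_sub_copula hW hk_nonneg hk_int hs
      (v := fun n j => n * (1 - u j ^ (1 / (n : ℝ))))
      (fun n j => mul_nonneg n.cast_nonneg
        (sub_nonneg.2 (Real.rpow_le_one (hu j).1 (hu j).2 (by positivity))))
      (fun j => tendsto_mul_one_sub_rpow (hpos j))
    have h2 : Tendsto (fun n : ℕ => (n : ℝ) *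
        (copula P (fun j => Z (s j)) (fun j => u j ^ (1 / (n : ℝ))) - 1)) atTop
        (𝓝 (-maxIntegral k s fun j => -Real.log (u j))) := by
      refine h.neg.congr' ?_
      filter_upwards [eventually_gt_atTop 0] with n hn
      have hn' : (n : ℝ) ≠ 0 := by positivity
      simp_rw [mul_div_cancel_left₀ _ hn', sub_sub_cancel]
      ring
    simpa using Real.tendsto_one_add_pow_exp_of_tendsto h2
  -- If some `u j = 0`, the copula itself vanishes for `n > 0`, because a Cauchy distribution
  -- function is positive everywhere.
  · rw [evCopula, if_neg hpos]
    push Not at hpos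
    obtain ⟨j, hj⟩ := hpos
    have hj0 : u j = 0 := le_antisymm hj (hu j).1
    have hK : (∫ x, k (s j) x).toNNReal ≠ 0 := by simpa using hs j
    refine tendsto_const_nhds.congr' ?_
    filter_upwards [eventually_gt_atTop 0] with n hn
    have h0 : copula P (fun j => Z (s j)) (fun j => u j ^ (1 / (n : ℝ))) = 0 := by
      have hn' : (1 / (n : ℝ)) ≠ 0 := by positivity
      rw [copula]
      convert! measureReal_empty (μ := P)
      refine eq_empty_of_forall_notMem fun ω hω => ?_
      have h1 := hω j
      rw [hj0, Real.zero_rpow hn', hZ.map_eq hW hk_nonneg hk_int] at h1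
      exact absurd (cdf_cauchyMeasure_pos hK _) (not_lt.2 h1)
    rw [h0, zero_pow hn.ne']

/-- The normalized maxima of independent copies of a convolution process converge in law. -/
lemma IsConvolutionProcess.tendsto_real_forall_le_pow (hZ : IsConvolutionProcess P W k Z)
    (hW : IsCauchyWhiteNoise P W) (hk_nonneg : ∀ s x, 0 ≤ k s x)
    (hk_int : ∀ s, Integrable (k s) volume) (hs : ∀ j, 0 < ∫ x, k (s j) x)
    {z : Fin d → ℝ} (hz : ∀ j, 0 < z j) :
    Tendsto (fun n : ℕ =>
      P.real {ω | ∀ j, Z (s j) ω ≤ (n : ℝ) * ((∫ x, k (s j) x) / Real.pi) * z j} ^ n) atTop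
      (𝓝 (Real.exp (-maxIntegral k s fun j => 1 / z j))) := by
  have hpi := Real.pi_pos
  have h := hW.tendsto_mul_real_exists_lt_mul (fun j => hk_int (s j)) (fun j => hk_nonneg (s j))
    (fun j => hZ (s j)) (b := fun _ j => Real.pi * (1 / z j) / ∫ y, k (s j) y)
    (Eventually.of_forall fun n j => div_nonneg
      (mul_nonneg hpi.le (one_div_nonneg.2 (hz j).le)) (hs j).le)
    (fun j => tendsto_const_nhds)
  rw [integral_iSup_eq_maxIntegral k s fun j => 1 / z j] at h
  have h2 := Real.tendsto_one_add_pow_exp_of_tendsto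
    (g := fun n : ℕ => -P.real {ω | ∃ j, n < Real.pi * (1 / z j) / (∫ y, k (s j) y) * Z (s j) ω})
    (h.neg.congr fun n => by ring)
  refine h2.congr fun n => ?_
  rw [real_forall_le_eq (fun j => (hZ (s j)).1), ← sub_eq_add_neg]
  congr 4
  ext ω
  refine exists_congr fun j => ?_
  have hsj := hs j
  have hzj := hz j
  rw [mul_one_div, div_div, div_mul_eq_mul_div, lt_div_iff₀ (by positivity), mul_div_assoc',
    div_mul_eq_mul_div, div_lt_iff₀ hpi, mul_comm (Z (s j) ω)]
  constructor <;> intro h <;> linarith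

end Copula

/-! ### The moving maximum process. -/

section Poisson

/-- The void probability. The kernels are only a.e. measurable, so `A` is squeezed between
measurable sets of the same intensity. -/
lemma IsPoissonProcess.measure_forall_notMem {Ω S : Type*} [MeasurableSpace Ω] [MeasurableSpace S]
    {P : Measure Ω} {ν : Measure S} {T : ℕ → Ω → S} (hT : IsPoissonProcess P ν T) {A : Set S}
    (hA : NullMeasurableSet A ν) (hA' : ν A < ∞) :
    P {ω | ∀ i, T i ω ∉ A} = ENNReal.ofReal (Real.exp (-(ν A).toReal)) := by
  have key : ∀ B : Set S, MeasurableSet B → ν B = ν A →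
      P {ω | ∀ i, T i ω ∉ B} = ENNReal.ofReal (Real.exp (-(ν A).toReal)) := by
    intro B hB hBA
    have h := hT.law B hB (hBA ▸ hA') 0
    rw [hBA] at h
    have h1 : {ω | ∀ i, T i ω ∉ B} = {ω | pointCount T B ω = (0 : ℕ)} := by
      ext ω
      simp [pointCount, Set.eq_empty_iff_forall_notMem]
    rw [h1, h]
    simp
  obtain ⟨B, hAB, hB, hB'⟩ := hA.exists_measurable_superset_ae_eq
  obtain ⟨C, hCA, hC, hC'⟩ := hA.exists_measurable_subset_ae_eq
  refine le_antisymm ?_ ?_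
  · rw [← key C hC (measure_congr hC')]
    exact measure_mono fun ω hω i hi => hω i (hCA hi)
  · rw [← key B hB (measure_congr hB')]
    exact measure_mono fun ω hω i hi => hω i (hAB hi)

lemma withDensity_inv_sq_Ioi {r : ℝ} (hr : 0 < r) :
    ((volume.restrict (Ioi (0 : ℝ))).withDensity fun ξ => ENNReal.ofReal (ξ ^ 2)⁻¹) (Ioi r)
      = ENNReal.ofReal r⁻¹ := by
  rw [withDensity_apply _ measurableSet_Ioi, Measure.restrict_restrict measurableSet_Ioi,
    inter_eq_self_of_subset_left (Ioi_subset_Ioi hr.le)]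
  have h1 : ∀ ξ ∈ Ioi r, ((ξ ^ 2)⁻¹ : ℝ) = ξ ^ (-2 : ℝ) := fun ξ hξ => by
    rw [Real.rpow_neg (hr.trans hξ).le]; norm_cast
  have h2 : IntegrableOn (fun ξ : ℝ => (ξ ^ 2)⁻¹) (Ioi r) :=
    (integrableOn_Ioi_rpow_of_lt (by norm_num) hr).congr_fun (fun ξ hξ => (h1 ξ hξ).symm)
      measurableSet_Ioi
  rw [← ofReal_integral_eq_lintegral_ofReal h2 (ae_of_all _ fun ξ => by positivity),
    setIntegral_congr_fun measurableSet_Ioi h1, integral_Ioi_rpow_of_lt (by norm_num) hr]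
  congr 1
  norm_num
  rw [Real.rpow_neg_one]

lemma withDensity_inv_sq_lt_mul {M : ℝ} (hM : 0 ≤ M) :
    ((volume.restrict (Ioi (0 : ℝ))).withDensity fun ξ => ENNReal.ofReal (ξ ^ 2)⁻¹)
      {ξ | 1 < M * ξ} = ENNReal.ofReal M := by
  rcases hM.eq_or_lt with rfl | hM
  · have : {ξ : ℝ | 1 < 0 * ξ} = ∅ :=
      eq_empty_of_forall_notMem fun ξ hξ => by
        rw [mem_ofPred_eq, zero_mul] at hξ
        linarith
    rw [this, measure_empty, ENNReal.ofReal_zero]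
  · have : {ξ | 1 < M * ξ} = Ioi M⁻¹ := by
      ext ξ
      rw [mem_ofPred_eq, mem_Ioi, inv_lt_iff_one_lt_mul₀' hM]
    rw [this, withDensity_inv_sq_Ioi (inv_pos.2 hM), inv_inv]

variable {κ : Type*} [Fintype κ] {g : κ → Plane → ℝ}

lemma nullMeasurableSet_exists_lt_mul (hg : ∀ j, Integrable (g j) volume) (z : κ → ℝ) :
    NullMeasurableSet {p : ℝ × Plane | ∃ j, z j < p.1 * g j p.2} maxIntensity := by
  rw [ofPred_exists]
  refine .iUnion fun j => nullMeasurableSet_lt aemeasurable_const ?_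
  exact measurable_fst.aemeasurable.mul ((hg j).aemeasurable.comp_snd)

/-- For fixed `x`, the section in `ξ` is `{ξ | 1 < M * ξ}` with `M = max_j g j x / z j`, and `ξ⁻²
dξ` gives it mass exactly `M`. -/
lemma maxIntensity_exists_lt_mul (hg : ∀ j, Integrable (g j) volume) (hg0 : ∀ j x, 0 ≤ g j x)
    {z : κ → ℝ} (hz : ∀ j, 0 < z j) :
    maxIntensity {p : ℝ × Plane | ∃ j, z j < p.1 * g j p.2}
      = ENNReal.ofReal (∫ x, ⨆ j, 1 / z j * g j x) := by
  have hnull := nullMeasurableSet_exists_lt_mul hg z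
  rw [← lintegral_indicator_one₀ hnull, maxIntensity, lintegral_prod_symm]
  swap
  · exact (aemeasurable_indicator_const_iff 1).2 hnull
  have h0 : ∀ j x, 0 ≤ 1 / z j * g j x := fun j x =>
    mul_nonneg (one_div_nonneg.2 (hz j).le) (hg0 j x)
  rw [ofReal_integral_eq_lintegral_ofReal (integrable_iSup fun j => (hg j).const_mul _)
    (ae_of_all _ fun x => Real.iSup_nonneg fun j => h0 j x)]
  refine lintegral_congr fun x => ?_
  rw [← withDensity_inv_sq_lt_mul (Real.iSup_nonneg fun j => h0 j x)]
  have hset : {ξ : ℝ | ∃ j, z j < ξ * g j x} = {ξ | 1 < (⨆ j, 1 / z j * g j x) * ξ} := by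
    ext ξ
    refine Iff.trans (exists_congr fun j => ?_)
      (exists_lt_mul_iff_lt_iSup_mul (fun j => 1 / z j * g j x) zero_le_one fun j => h0 j x)
    rw [one_div_mul_eq_div, div_mul_eq_mul_div, lt_div_iff₀ (hz j), one_mul, mul_comm]
  rw [← hset, ← lintegral_indicator_one]
  · rfl
  · rw [hset]
    exact measurableSet_lt measurable_const (by fun_prop)

/-- The joint distribution function of the moving maximum process. -/
lemma real_forall_movingMaximum_le {Ω : Type*} [MeasurableSpace Ω] {P : Measure Ω}
    {T : ℕ → Ω → ℝ × Plane} (hT : IsPoissonProcess P maxIntensity T) {ζ : Plane → Plane → ℝ}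
    {s : κ → Plane} (hζ : ∀ j, Integrable (ζ (s j)) volume) (hζ0 : ∀ j x, 0 ≤ ζ (s j) x)
    {z : κ → ℝ} (hz : ∀ j, 0 < z j) :
    P.real {ω | ∀ j, movingMaximum ζ T (s j) ω ≤ ENNReal.ofReal (z j)}
      = Real.exp (-∫ x, ⨆ j, 1 / z j * ζ (s j) x) := by
  have h1 := maxIntensity_exists_lt_mul hζ hζ0 hz
  have h2 := hT.measure_forall_notMem (nullMeasurableSet_exists_lt_mul hζ z) (by simp [h1])
  rw [h1, ENNReal.toReal_ofReal (integral_nonneg fun x => Real.iSup_nonneg fun j =>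
    mul_nonneg (one_div_nonneg.2 (hz j).le) (hζ0 j x))] at h2
  have h3 : {ω | ∀ j, movingMaximum ζ T (s j) ω ≤ ENNReal.ofReal (z j)}
      = {ω | ∀ i, T i ω ∉ {p : ℝ × Plane | ∃ j, z j < p.1 * ζ (s j) p.2}} := by
    ext ω
    simp only [mem_ofPred_eq, movingMaximum, iSup_le_iff, ENNReal.ofReal_le_ofReal_iff (hz _).le,
      not_exists, not_lt]
    exact forall_comm
  rw [h3, measureReal_def, h2, ENNReal.toReal_ofReal (Real.exp_pos _).le]

end Poisson

end CauchyConv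

theorem proposition1 {Ω : Type*} [MeasurableSpace Ω] (P : Measure Ω) [IsProbabilityMeasure P]
    (W : Set CauchyConv.Plane → Ω → ℝ) (hW : CauchyConv.IsCauchyWhiteNoise P W)
    (k : CauchyConv.Plane → CauchyConv.Plane → ℝ)
    (hk_nonneg : ∀ s x, 0 ≤ k s x)
    (hk_bdd : ∃ kmax : ℝ, ∀ s x, k s x ≤ kmax)
    (hk_int : ∀ s, Integrable (k s) volume)
    (Z : CauchyConv.Plane → Ω → ℝ) (hZ : CauchyConv.IsConvolutionProcess P W k Z)
    {d : ℕ} (s : Fin d → CauchyConv.Plane) (hs : ∀ j, 0 < ∫ x, k (s j) x) :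
    -- the integral `∫ max_j w_j ζ(s_j, x) dx` converges
    (∀ w : Fin d → ℝ, (∀ j, 0 ≤ w j) →
      Integrable (fun x => ⨆ j, w j * CauchyConv.normalizedKernel k (s j) x) volume) ∧
    -- it is the stable tail dependence function of `(Z(s_1), …, Z(s_d))`
    CauchyConv.IsStableTailDependenceFunction
      (CauchyConv.copula P fun j => Z (s j)) (CauchyConv.maxIntegral k s) ∧
    -- the extreme-value limit is the moving maximum process, and that process is max-stable
    ∀ (Ω' : Type*) [MeasurableSpace Ω'] (P' : Measure Ω') [IsProbabilityMeasure P']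
      (T : ℕ → Ω' → ℝ × CauchyConv.Plane),
      CauchyConv.IsPoissonProcess P' CauchyConv.maxIntensity T →
      ∀ z : Fin d → ℝ, (∀ j, 0 < z j) →
        -- joint distribution function of the moving maximum process at the sites
        P'.real {ω | ∀ j, CauchyConv.movingMaximum (CauchyConv.normalizedKernel k) T (s j) ω
            ≤ ENNReal.ofReal (z j)} =
            Real.exp (-CauchyConv.maxIntegral k s fun j => 1 / z j) ∧
        -- the componentwise maxima of `n` independent copies of `(Z(s_1), …, Z(s_d))`, divided
        -- by `n ∫ k(s_j, x) dx / π`, converge in distribution to the moving maximum process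
        Tendsto (fun n : ℕ =>
            P.real {ω | ∀ j, Z (s j) ω ≤ (n : ℝ) * ((∫ x, k (s j) x) / Real.pi) * z j} ^ n) atTop
          (𝓝 (P'.real {ω | ∀ j,
            CauchyConv.movingMaximum (CauchyConv.normalizedKernel k) T (s j) ω
              ≤ ENNReal.ofReal (z j)})) ∧
        -- max-stability: the maximum of `n` independent copies, divided by `n`, has the same law
        ∀ n : ℕ, 1 ≤ n →
          P'.real {ω | ∀ j, CauchyConv.movingMaximum (CauchyConv.normalizedKernel k) T (s j) ω
              ≤ ENNReal.ofReal ((n : ℝ) * z j)} ^ n =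
            P'.real {ω | ∀ j, CauchyConv.movingMaximum (CauchyConv.normalizedKernel k) T (s j) ω
              ≤ ENNReal.ofReal (z j)} := by
  have hζ : ∀ j, Integrable (CauchyConv.normalizedKernel k (s j)) volume := fun j =>
    (hk_int (s j)).div_const _
  have hζ0 : ∀ j x, 0 ≤ CauchyConv.normalizedKernel k (s j) x := fun j x =>
    div_nonneg (hk_nonneg _ _) (hs j).le
  refine ⟨fun w _ => CauchyConv.integrable_iSup fun j => (hζ j).const_mul (w j),
    hZ.isStableTailDependenceFunction hW hk_nonneg hk_int hs, ?_⟩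
  intro Ω' _ P' _ T hT z hz
  have hmm : ∀ z : Fin d → ℝ, (∀ j, 0 < z j) →
      P'.real {ω | ∀ j, CauchyConv.movingMaximum (CauchyConv.normalizedKernel k) T (s j) ω
        ≤ ENNReal.ofReal (z j)} = Real.exp (-CauchyConv.maxIntegral k s fun j => 1 / z j) :=
    fun z hz => CauchyConv.real_forall_movingMaximum_le hT hζ hζ0 hz
  refine ⟨hmm z hz, ?_, fun n hn => ?_⟩
  · rw [hmm z hz]
    exact hZ.tendsto_real_forall_le_pow hW hk_nonneg hk_int hs hz
  · have hn' : (0 : ℝ) < n := by exact_mod_cast hn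
    -- What remains is homogeneity: the factor `n` from the power cancels the `1 / n` inside the
    -- maximum.
    rw [hmm z hz, hmm (fun j => n * z j) fun j => mul_pos hn' (hz j), ← Real.exp_nat_mul,
      mul_neg, CauchyConv.maxIntegral, CauchyConv.maxIntegral, ← integral_const_mul]
    congr 3
    ext x
    rw [Real.mul_iSup_of_nonneg hn'.le]
    congr 1
    ext j
    have := (hz j).ne'
    field_simp
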